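/- Consider a slotted-time network with $r\ge 1$ queues. The network state $S(t)$, $t=0,1,2,\dots$, is an irreducible aperiodic Markov chain on a countable set $\mathcal S$ with a steady state distribution $\pi$, started in an arbitrary state $S(0)=s_0$. In state $s$ the controller chooses an action $x$ from a compact set $\mathcal X^{(s)}$, which incurs a cost $f(s,x)$, brings $A_j(s,x)\ge 0$ units of traffic to queue $j$ and offers it $\mu_j(s,x)\ge 0$ units of service. Here $f$ is everywhere nonnegative or everywhere nonpositive, and $|f|,A_j,\mu_j\le\delta_{\max}$ for a constant $\delta_{\max}\in(0,\infty)$. With $x(t)$ the action chosen in slot $t$, the backlogs satisfy $q_j(0)=0$ and $q_j(t+1)=\max[q_j(t)-\mu_j(S(t),x(t)),0]+A_j(S(t),x(t))$. For a policy (possibly randomized and history dependent, not anticipating the future of $S$), let $$f_{av}=\limsup_{t\to\infty}\frac1t\sum_{\tau=0}^{t-1}\mathbb E[f(S(\tau),x(\tau))],\qquad \overline{\textstyle\sum_j q_j}=\limsup_{t\to\infty}\frac1t\sum_{\tau=0}^{t-1}\sum_{j=1}^r\mathbb E[q_j(\tau)].$$ The policy is stable if $\overline{\sum_j q_j}<\infty$,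 and $f^*_{av}$ is the infimum of $f_{av}$ over all stable policies. For $V\ge1$, QLA (MaxWeight) is a policy that in every slot chooses $x(t)\in\mathcal X^{(S(t))}$ maximizing $-Vf(S(t),x)+\sum_j q_j(t)[\mu_j(S(t),x)-A_j(S(t),x)]$. Assume the $\eta$-slackness condition: for some $\eta>0$ there are actions $x^{(s)}_k\in\mathcal X^{(s)}$ and weights $\vartheta^{(s)}_k\ge0$ with $\sum_{k}\vartheta^{(s)}_k=1$ ($s\in\mathcal S$, $k=1,\dots,r+2$) such that, for all $j$, $$\sum_{s}\pi_s\sum_k\vartheta^{(s)}_k\big[A_j(s,x^{(s)}_k)-\mu_j(s,x^{(s)}_k)\big]\le-\eta .$$ Assume also that there is a state $s_1$ such that, from every starting state (including $s_1$), the first time $T>0$ at which the chain is in $s_1$ has a finite second moment. Let $\overline{T_1}$ and $\overline{T_1^2}$ be the first and second moments of the return time to $s_1$, and put $B=\sqrt r\,\delta_{\max}$, $C=\overline{T_1^2}+\overline{T_1}$, $D=\overline{T_1^2}-\overline{T_1}$. Then for every $V\ge1$ and every starting state, QLA satisfies $$f^{QLA}_{av}\le f^*_{av}+\frac{CB^2}{V\,\overline{T_1}},\qquad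 \overline{\textstyle\sum_{j} q_j}\le\frac{CB^2+\overline{T_1}\,V\delta_{\max}}{\eta}+\frac{DB^2}{2}.$$ In particular, there is a constant $K>0$, independent of $V$ and of the starting state, such that $f^{QLA}_{av}\le f^*_{av}+K/V$ and $\overline{\sum_j q_j}\le KV$ for all $V\ge1$ (an $[O(1/V),O(V)]$ utility-delay tradeoff). -/

import Mathlib

open MeasureTheory Filter Topology
open scoped ENNReal

universe u v w

/-! ## Markov chains with transition law `P : S → PMF S` -/

namespace MarkovChain

variable {S : Type v}

/-- Law of the chain after `n` steps, started in `i`. -/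
noncomputable def stepLaw (P : S → PMF S) (i : S) : ℕ → PMF S
  | 0 => PMF.pure i
  | n + 1 => (stepLaw P i n).bind P

/-- Every state can be reached from every state. -/
def Irreducible (P : S → PMF S) : Prop :=
  ∀ i j, ∃ n, 0 < stepLaw P i n j

/-- For every state the possible (positive) return times have greatest common divisor one. -/
def Aperiodic (P : S → PMF S) : Prop :=
  ∀ i, ∀ d : ℕ, (∀ n, 0 < n → 0 < stepLaw P i n i → d ∣ n) → d = 1

/-- `firstPassage P j n i` is the probability, for the chain started in `i` at time `0`, that
`inf {T > 0 : S(T) = j}` equals `n`. -/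
noncomputable def firstPassage (P : S → PMF S) (j : S) : ℕ → S → ℝ≥0∞
  | 0, _ => 0
  | 1, i => P i j
  | n + 2, i => ∑' k : {k : S // k ≠ j}, P i k * firstPassage P j (n + 1) k

/-- The `p`-th moment (with values in `[0, ∞]`) of the first time `T = inf {T > 0 : S(T) = j}` of
the chain started in `i`. The last summand is the contribution of the event `T = ∞`
(in `ℝ≥0∞`, `⊤ * 0 = 0`). For `i = j` this is a moment of the return time. -/
noncomputable def hittingMoment (P : S → PMF S) (p : ℕ) (i j : S) : ℝ≥0∞ :=
  (∑' n : ℕ, (n : ℝ≥0∞) ^ p * firstPassage P j n i)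
    + ⊤ * (1 - ∑' n : ℕ, firstPassage P j n i)

/-- Mean return time to `s`. -/
noncomputable def meanReturn (P : S → PMF S) (s : S) : ℝ :=
  (hittingMoment P 1 s s).toReal

/-- Second moment of the return time to `s`. -/
noncomputable def secondReturn (P : S → PMF S) (s : S) : ℝ :=
  (hittingMoment P 2 s s).toReal

end MarkovChain

/-- `limsup_{t → ∞} (1/t) ∑_{τ < t} a τ`, as an extended real number. -/
noncomputable def limsupTimeAverage (a : ℕ → ℝ) : EReal :=
  limsup (fun t : ℕ => (((1 / (t : ℝ)) * ∑ τ ∈ Finset.range t, a τ : ℝ) : EReal)) atTop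

/-! ## The stochastic network -/

/-- A slotted-time stochastic network with `r` queues, network states in `S` and actions in `X`. -/
structure StochasticNetwork (S : Type v) (X : Type w) [TopologicalSpace X] [MeasurableSpace X]
    (r : ℕ) where
  /-- transition law of the network state -/
  P : S → PMF S
  irreducible : MarkovChain.Irreducible P
  aperiodic : MarkovChain.Aperiodic P
  /-- steady state distribution -/
  steady : PMF S
  stationary : steady.bind P = steady
  /-- feasible actions in a given network state -/
  feasible : S → Set X
  isCompact_feasible : ∀ s, IsCompact (feasible s)
  /-- cost of an action -/
  cost : S → X → ℝ
  /-- traffic that an action generates for queue `j` -/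
  traffic : Fin r → S → X → ℝ
  /-- service that an action allocates to queue `j` -/
  service : Fin r → S → X → ℝ
  measurable_cost : ∀ s, Measurable (cost s)
  measurable_traffic : ∀ j s, Measurable (traffic j s)
  measurable_service : ∀ j s, Measurable (service j s)
  /-- costs are nonnegative, or (reward maximization) they are nonpositive -/
  cost_sign : (∀ s, ∀ x ∈ feasible s, 0 ≤ cost s x) ∨ (∀ s, ∀ x ∈ feasible s, cost s x ≤ 0)
  traffic_nonneg : ∀ j s, ∀ x ∈ feasible s, 0 ≤ traffic j s x
  service_nonneg : ∀ j s, ∀ x ∈ feasible s, 0 ≤ service j s x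
  /-- uniform bound on the magnitudes -/
  deltaMax : ℝ
  deltaMax_pos : 0 < deltaMax
  abs_cost_le : ∀ s, ∀ x ∈ feasible s, |cost s x| ≤ deltaMax
  traffic_le : ∀ j s, ∀ x ∈ feasible s, traffic j s x ≤ deltaMax
  service_le : ∀ j s, ∀ x ∈ feasible s, service j s x ≤ deltaMax

namespace StochasticNetwork

variable {S : Type v} {X : Type w} [TopologicalSpace X] [MeasurableSpace X] {r : ℕ}

/-- `B = √r · δ_max`. -/
noncomputable def B (N : StochasticNetwork S X r) : ℝ := Real.sqrt r * N.deltaMax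

/-- The `η`-slackness condition: a stationary randomized choice among `r + 2` actions per state
gives every queue a steady state drift of at most `-η`, with `η > 0`. -/
def Slackness (N : StochasticNetwork S X r) (η : ℝ) : Prop :=
  0 < η ∧
  ∃ (x : S → Fin (r + 2) → X) (θ : S → Fin (r + 2) → ℝ),
    (∀ s k, x s k ∈ N.feasible s) ∧ (∀ s k, 0 ≤ θ s k) ∧ (∀ s, ∑ k, θ s k = 1) ∧
    ∀ j, ∑' s, (N.steady s).toReal *
      ∑ k, θ s k * (N.traffic j s (x s k) - N.service j s (x s k)) ≤ -η

/-- A feasible action-choosing policy run on the network that starts in the state `s₀`: on some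
probability space, with the information `ℱ t` that is available in slot `t` (it may contain
randomization of the controller), the network state is a Markov chain with transition law `P` with
respect to this information, and the action of slot `t` is chosen from the feasible set of the
current network state on the basis of this information. -/
structure Policy (N : StochasticNetwork S X r) (s₀ : S) where
  Ω : Type u
  [mΩ : MeasurableSpace Ω]
  ℙ : Measure Ω
  [isProb : IsProbabilityMeasure ℙ]
  ℱ : Filtration ℕ mΩ
  state : ℕ → Ω → S
  action : ℕ → Ω → X
  state_adapted : ∀ t s, MeasurableSet[ℱ t] {ω | state t ω = s}
  action_adapted : ∀ t, Measurable[ℱ t] (action t)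
  initial : ∀ᵐ ω ∂ℙ, state 0 ω = s₀
  /-- `ℙ (S(t+1) = j | ℱ t) = P (S(t), j)`, integrated over the events of `ℱ t` -/
  markov : ∀ (t : ℕ) (E : Set Ω), MeasurableSet[ℱ t] E → ∀ i j : S,
    ℙ (E ∩ {ω | state t ω = i} ∩ {ω | state (t + 1) ω = j})
      = ℙ (E ∩ {ω | state t ω = i}) * N.P i j
  action_feasible : ∀ t, ∀ᵐ ω ∂ℙ, action t ω ∈ N.feasible (state t ω)

attribute [instance] Policy.mΩ Policy.isProb

namespace Policy

variable {N : StochasticNetwork S X r} {s₀ : S}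

/-- Queue backlogs: `q(0) = 0` and `q_j(t+1) = max (q_j(t) - μ_j(t)) 0 + A_j(t)`. -/
noncomputable def queue (pol : Policy.{u} N s₀) : ℕ → pol.Ω → Fin r → ℝ
  | 0, _, _ => 0
  | t + 1, ω, j =>
      max (queue pol t ω j - N.service j (pol.state t ω) (pol.action t ω)) 0
        + N.traffic j (pol.state t ω) (pol.action t ω)

/-- Time average expected cost. -/
noncomputable def avgCost (pol : Policy.{u} N s₀) : EReal :=
  limsupTimeAverage fun τ => ∫ ω, N.cost (pol.state τ ω) (pol.action τ ω) ∂pol.ℙ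

/-- Time average expected total backlog. -/
noncomputable def avgBacklog (pol : Policy.{u} N s₀) : EReal :=
  limsupTimeAverage fun τ => ∑ j, ∫ ω, pol.queue τ ω j ∂pol.ℙ

/-- The queues are stable. -/
def Stable (pol : Policy.{u} N s₀) : Prop := pol.avgBacklog < ⊤

/-- QLA (MaxWeight) with parameter `V`: in every slot the action maximizes
`-V f(S(t), x) + ∑ j, q_j(t) (μ_j(S(t), x) - A_j(S(t), x))` over the feasible actions; ties are
broken arbitrarily. -/
def IsQLA (pol : Policy.{u} N s₀) (V : ℝ) : Prop :=
  ∀ t, ∀ᵐ ω ∂pol.ℙ,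
    IsMaxOn (fun x => -V * N.cost (pol.state t ω) x
        + ∑ j, pol.queue t ω j *
            (N.service j (pol.state t ω) x - N.traffic j (pol.state t ω) x))
      (N.feasible (pol.state t ω)) (pol.action t ω)

end Policy

/-- `f*_av`: the optimal time average cost over all stable policies, for the network started
in `s₀`. -/
noncomputable def optCost (N : StochasticNetwork S X r) (s₀ : S) : EReal :=
  ⨅ (pol : Policy.{u} N s₀) (_ : pol.Stable), pol.avgCost

/-- `C`: sum of the second and the first moment of the return time to `s₁`. -/
noncomputable def constC (N : StochasticNetwork S X r) (s₁ : S) : ℝ :=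
  MarkovChain.secondReturn N.P s₁ + MarkovChain.meanReturn N.P s₁

/-- `D`: difference of the second and the first moment of the return time to `s₁`. -/
noncomputable def constD (N : StochasticNetwork S X r) (s₁ : S) : ℝ :=
  MarkovChain.secondReturn N.P s₁ - MarkovChain.meanReturn N.P s₁

end StochasticNetwork

/-! Freeze the backlogs at q and let g(q,s) be the least value of V f + ∑ q_j (A_j − μ_j) over the
actions feasible in s. MaxWeight attains this minimum, so in slot t the drift of ½∑ q_j² plus V f is
at most B² + g(q(t),S(t)) (`lyapunov_succ_le`), and everything rests on the long run sum of
g(q(t),S(t)).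

The state does not equilibrate within a slot, so g is replaced by means of a corrector: h(q,s), the
expected sum of g(q,·) before the first passage from s to s₁ (`passageWeight`). Once set to zero at
s₁, it solves a Poisson equation (`tsum_mul_killed_passageWeight`). The sum of g therefore
telescopes up to two terms: the weight h(q(t),s₁) of a full cycle at each visit to s₁, and an error
of at most B² times the mean remaining passage time, caused by the motion of the backlogs
(`integral_minWeight_queue_le`). Visits have frequency 1/T, where T is the mean return time, and the
remaining passage time averages to D/(2T). The total error is thus B² + B²D/(2T) = B²C/(2T). The
corrector left at the final time is absorbed by the quadratic function up to o(n)
(`neg_le_lyapunov_add_weightPotential`, `tendsto_stateMean_passage_two`).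

Cost: h(q,s₁)/T is the long run average of g(q,·). For a stable policy, g(q,S(t)) is at most V f
plus ∑ q_j times the increment of the j-th backlog; after averaging, stability removes the backlogs
along a subsequence. So h(q,s₁) ≤ T V f_av for every q ≥ 0 (weak duality,
`passageWeight_le_avgCost`), which is just the bound needed for the visit terms. No optimal policy
or strong duality enters.

Backlog: Kac's formula and slackness give h(q,s₁) ≤ V c − ηT∑ q_j
(`Slackness.exists_passageWeight_le`). This bounds the backlog seen at visits to s₁, and a second
telescoping, with the mean remaining passage time as corrector, carries the bound to all slots
(`meanBacklog_le`). -/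

namespace MarkovChain

/-! ### The chain killed at `j`: passage moments, occupation, Kac's formula -/

section Taboo

open scoped Classical in
/-- One step of the chain killed at the state `j`, acting on functions. -/
noncomputable def taboo {S : Type v} (P : S → PMF S) (j : S) (d : S → ℝ≥0∞) : S → ℝ≥0∞ :=
  fun i => ∑' k, (if k = j then 0 else P i k) * d k

variable {S : Type v} (P : S → PMF S) (j : S)

theorem taboo_mono {d d' : S → ℝ≥0∞} (h : d ≤ d') : taboo P j d ≤ taboo P j d' :=
  fun _ => ENNReal.tsum_le_tsum fun k => mul_le_mul_right (h k) _

theorem taboo_add (d d' : S → ℝ≥0∞) : taboo P j (d + d') = taboo P j d + taboo P j d' := by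
  funext i
  simp only [taboo, Pi.add_apply, mul_add, ENNReal.tsum_add]

theorem taboo_tsum {ι : Type*} (d : ι → S → ℝ≥0∞) :
    taboo P j (fun k => ∑' n, d n k) = fun i => ∑' n, taboo P j (d n) i := by
  funext i
  simp only [taboo, ← ENNReal.tsum_mul_left]
  exact ENNReal.tsum_comm

theorem taboo_const_mul (c : ℝ≥0∞) (d : S → ℝ≥0∞) :
    taboo P j (fun k => c * d k) = fun i => c * taboo P j d i := by
  funext i
  simp only [taboo, ← ENNReal.tsum_mul_left]
  exact tsum_congr fun k => by ring

theorem taboo_iterate_mono {d d' : S → ℝ≥0∞} (h : d ≤ d') (n : ℕ) :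
    (taboo P j)^[n] d ≤ (taboo P j)^[n] d' := by
  induction n with
  | zero => simpa using h
  | succ n ih => simpa only [Function.iterate_succ_apply'] using taboo_mono P j ih

theorem taboo_iterate_tsum {ι : Type*} (d : ι → S → ℝ≥0∞) (n : ℕ) :
    (taboo P j)^[n] (fun k => ∑' m, d m k) = fun i => ∑' m, (taboo P j)^[n] (d m) i := by
  induction n with
  | zero => rfl
  | succ n ih => simp only [Function.iterate_succ_apply', ih, taboo_tsum]

theorem tsum_mul_eq_taboo_add (d : S → ℝ≥0∞) (i : S) :
    ∑' k, P i k * d k = taboo P j d i + P i j * d j := by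
  classical
  have : ∀ k, P i k * d k = (if k = j then 0 else P i k) * d k
      + (if k = j then P i j * d j else 0) := by
    intro k; by_cases h : k = j <;> simp [h]
  rw [tsum_congr this, ENNReal.tsum_add, tsum_ite_eq]
  simp only [taboo]

theorem taboo_one_add (i : S) : taboo P j 1 i + P i j = 1 := by
  have := tsum_mul_eq_taboo_add P j 1 i
  simpa [PMF.tsum_coe] using this.symm

theorem firstPassage_succ_succ (n : ℕ) :
    firstPassage P j (n + 2) = taboo P j (firstPassage P j (n + 1)) := by
  classical
  funext i
  simp only [firstPassage, taboo]
  refine (tsum_subtype {k | k ≠ j} (fun k => P i k * firstPassage P j (n + 1) k)).trans ?_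
  refine tsum_congr fun k => ?_
  by_cases h : k = j <;> simp [h]

/-- The `p`-th moment of `T - h` on the event `T > h`, for the first passage time `T` to `j`. -/
noncomputable def excess (p h : ℕ) (i : S) : ℝ≥0∞ :=
  ∑' n : ℕ, ((n + 1 : ℕ) : ℝ≥0∞) ^ p * firstPassage P j (n + 1 + h) i

/-- Surviving one more step of the killed chain uses up one unit of the passage time, so the killed
step acts on these moments as a shift of `h`. -/
theorem taboo_excess (p h : ℕ) : taboo P j (excess P j p h) = excess P j p (h + 1) := by
  unfold excess
  rw [taboo_tsum]
  funext i
  refine tsum_congr fun n => ?_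
  rw [taboo_const_mul]
  have : firstPassage P j (n + 1 + (h + 1)) = taboo P j (firstPassage P j (n + 1 + h)) := by
    have := firstPassage_succ_succ P j (n + h)
    rwa [show n + h + 2 = n + 1 + (h + 1) by ring, show n + h + 1 = n + 1 + h by ring] at this
  rw [this]

theorem taboo_iterate_excess (p h : ℕ) :
    (taboo P j)^[h] (excess P j p 0) = excess P j p h := by
  induction h with
  | zero => rfl
  | succ h ih => rw [Function.iterate_succ_apply', ih, taboo_excess]

theorem tsum_firstPassage_eq_excess (p : ℕ) (i : S) :
    ∑' n : ℕ, (n : ℝ≥0∞) ^ p * firstPassage P j n i = excess P j p 0 i := by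
  rw [tsum_eq_zero_add' ENNReal.summable]
  simp [excess, firstPassage]

theorem sum_firstPassage_le_one (h : ℕ) (i : S) :
    ∑ n ∈ Finset.range h, firstPassage P j (n + 1) i ≤ 1 := by
  induction h generalizing i with
  | zero => simp
  | succ h ih =>
    rw [Finset.sum_range_succ']
    have : ∑ n ∈ Finset.range h, firstPassage P j (n + 1 + 1) i
        = taboo P j (fun k => ∑ n ∈ Finset.range h, firstPassage P j (n + 1) k) i := by
      simp only [firstPassage_succ_succ]
      simp only [taboo, Finset.mul_sum]
      exact (Summable.tsum_finsetSum fun _ _ => ENNReal.summable).symm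
    rw [this, ← taboo_one_add P j i]
    exact add_le_add (taboo_mono P j (fun k => ih k) i) le_rfl

theorem excess_zero_zero_le_one (i : S) : excess P j 0 0 i ≤ 1 := by
  simp only [excess, pow_zero, one_mul, add_zero]
  exact ENNReal.tsum_le_of_sum_range_le fun n => sum_firstPassage_le_one P j n i

variable {P j}

/-- The summand `⊤ * P(T = ∞)` of `hittingMoment` can be finite only if the passage is almost surely
finite. -/
theorem excess_zero_zero_eq_one {p : ℕ} {i : S} (h : hittingMoment P p i j < ⊤) :
    excess P j 0 0 i = 1 := by
  refine le_antisymm (excess_zero_zero_le_one P j i) ?_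
  have h2 := (ENNReal.add_lt_top.1 h).2
  have h3 : (1 : ℝ≥0∞) - ∑' n : ℕ, firstPassage P j n i = 0 := by
    by_contra hne
    rw [ENNReal.top_mul hne] at h2
    exact lt_irrefl _ h2
  have h4 := tsum_firstPassage_eq_excess P j 0 i
  simp only [pow_zero, one_mul] at h4
  rw [h4] at h3
  exact tsub_eq_zero_iff_le.1 h3

theorem hittingMoment_eq_excess {p : ℕ} {i : S} (h0 : excess P j 0 0 i = 1) :
    hittingMoment P p i j = excess P j p 0 i := by
  have h4 := tsum_firstPassage_eq_excess P j 0 i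
  simp only [pow_zero, one_mul] at h4
  rw [hittingMoment, h4, h0, tsum_firstPassage_eq_excess]
  simp

theorem excess_mono_moment {p p' : ℕ} (h : p ≤ p') (i : S) :
    excess P j p 0 i ≤ excess P j p' 0 i := by
  refine ENNReal.tsum_le_tsum fun n => mul_le_mul_left ?_ _
  exact_mod_cast Nat.pow_le_pow_right (Nat.succ_pos n) h

theorem excess_le_zero (p h : ℕ) (i : S) : excess P j p h i ≤ excess P j p 0 i := by
  refine le_trans (ENNReal.tsum_le_tsum fun k => ?_)
    (ENNReal.tsum_comp_le_tsum_of_injective (f := fun m : ℕ => m + h) (add_left_injective h)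
      (fun n : ℕ => ((n + 1 : ℕ) : ℝ≥0∞) ^ p * firstPassage P j (n + 1 + 0) i))
  rw [show k + h + 1 + 0 = k + 1 + h by ring]
  refine mul_le_mul_left (pow_le_pow_left' ?_ p) _
  exact_mod_cast (by omega : k + 1 ≤ k + 1 + h)

/-- The moment of (T − n)⁺ is dominated by the n-th tail of the convergent series for the moment of
T. -/
theorem tendsto_excess {p : ℕ} {i : S} (h : excess P j p 0 i ≠ ⊤) :
    Tendsto (fun n => excess P j p n i) atTop (𝓝 0) := by
  refine tendsto_of_tendsto_of_tendsto_of_le_of_le tendsto_const_nhds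
    (ENNReal.tendsto_sum_nat_add
      (fun n : ℕ => ((n + 1 : ℕ) : ℝ≥0∞) ^ p * firstPassage P j (n + 1 + 0) i) h)
    (fun _ => zero_le) fun n => ?_
  refine ENNReal.tsum_le_tsum fun k => ?_
  rw [show k + n + 1 + 0 = k + 1 + n by ring]
  refine mul_le_mul_left (pow_le_pow_left' ?_ p) _
  exact_mod_cast (by omega : k + 1 ≤ k + 1 + n)

/-- First step analysis: T = 1 + (T − 1), where the second part survives only if the first step
misses `j`. -/
theorem excess_one_eq (i : S) :
    excess P j 1 0 i = excess P j 0 0 i + taboo P j (excess P j 1 0) i := by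
  rw [taboo_excess]
  simp only [excess, pow_one, pow_zero, one_mul, add_zero]
  rw [tsum_eq_zero_add' ENNReal.summable, tsum_eq_zero_add' (f := fun n =>
    firstPassage P j (n + 1) i) ENNReal.summable, add_assoc, ← ENNReal.tsum_add]
  congr 1
  · simp
  · refine tsum_congr fun n => ?_
    rw [show n + 1 + (0 + 1) = n + 1 + 1 by ring]
    push_cast
    ring

/-- First step analysis for T² = 1 + 2(T − 1) + (T − 1)². -/
theorem excess_two_eq (i : S) :
    excess P j 2 0 i = excess P j 0 0 i + 2 * taboo P j (excess P j 1 0) i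
      + taboo P j (excess P j 2 0) i := by
  rw [taboo_excess, taboo_excess]
  simp only [excess, pow_one, pow_zero, one_mul, add_zero]
  rw [tsum_eq_zero_add' ENNReal.summable, tsum_eq_zero_add' (f := fun n =>
    firstPassage P j (n + 1) i) ENNReal.summable, add_assoc, add_assoc, ← ENNReal.tsum_mul_left,
    ← ENNReal.tsum_add, ← ENNReal.tsum_add]
  congr 1
  · simp
  · refine tsum_congr fun n => ?_
    rw [show n + 1 + (0 + 1) = n + 1 + 1 by ring]
    push_cast
    ring

open scoped Classical in
/-- Expected number of visits to `k` strictly before the first passage to `j`, from `i`. -/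
noncomputable def occupation (P : S → PMF S) (j i k : S) : ℝ≥0∞ :=
  ∑' n : ℕ, (taboo P j)^[n] (fun s => if s = k then 1 else 0) i

open scoped Classical in
theorem occupation_eq (i k : S) :
    occupation P j i k
      = (if i = k then 1 else 0) + taboo P j (fun s => occupation P j s k) i := by
  unfold occupation
  rw [tsum_eq_zero_add' ENNReal.summable, taboo_tsum]
  simp only [Function.iterate_succ_apply', Function.iterate_zero, id]

/-- Both sides are ∑ P(T > n): the iterates of the killed kernel on the constant 1 are the survival
probabilities. -/
theorem tsum_occupation_eq (h0 : ∀ i, excess P j 0 0 i = 1) {i : S}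
    (h1 : excess P j 1 0 i ≠ ⊤) : ∑' k, occupation P j i k = excess P j 1 0 i := by
  classical
  have hrow : ∑' k, occupation P j i k = ∑' n : ℕ, (taboo P j)^[n] 1 i := by
    unfold occupation
    rw [ENNReal.tsum_comm]
    refine tsum_congr fun n => ?_
    have := congrFun (taboo_iterate_tsum P j (fun k s => if s = k then (1 : ℝ≥0∞) else 0) n) i
    rw [← this]
    refine congrFun (congrArg _ ?_) i
    funext s
    simp
  rw [hrow]
  -- This is E[min(T, h)] + E[(T − h)⁺] = E[T]; the second term vanishes as h grows.
  have hpart : ∀ (h : ℕ), ∑ n ∈ Finset.range h, (taboo P j)^[n] 1 i + excess P j 1 h i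
      = excess P j 1 0 i := by
    intro h
    induction h with
    | zero => simp
    | succ h ih =>
      rw [← ih, Finset.sum_range_succ, add_assoc]
      congr 1
      have h2 : excess P j 1 0 = 1 + taboo P j (excess P j 1 0) := by
        funext i; rw [excess_one_eq, h0 i]; rfl
      have hadd : ∀ n, ∀ d d' : S → ℝ≥0∞, (taboo P j)^[n] (d + d')
          = (taboo P j)^[n] d + (taboo P j)^[n] d' := by
        intro n
        induction n with
        | zero => intro d d'; rfl
        | succ n ih => intro d d'; simp only [Function.iterate_succ_apply, taboo_add, ih]
      rw [← taboo_iterate_excess P j 1 h]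
      conv_rhs => rw [h2, hadd]
      rw [← Function.iterate_succ_apply, taboo_iterate_excess]
      rfl
  have hl := (ENNReal.summable (f := fun n => (taboo P j)^[n] 1 i)).hasSum.tendsto_sum_nat.add
    (tendsto_excess h1)
  simp only [hpart, add_zero] at hl
  exact tendsto_nhds_unique hl tendsto_const_nhds

/-- Split each stationary step according to whether it lands in `j`. Iterating expresses `π k` as `π
j` times the expected visits to `k` in a truncated cycle, plus the mass that has avoided `j`
throughout; this mass tends to zero since the passage time is finite. -/
theorem stationary_eq_mul_occupation {π : PMF S} (hπ : π.bind P = π)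
    (h0 : ∀ i, excess P j 0 0 i = 1) (k : S) : π k = π j * occupation P j j k := by
  classical
  have hinv : ∀ d : S → ℝ≥0∞, ∑' i, π i * ∑' l, P i l * d l = ∑' i, π i * d i := by
    intro d
    conv_rhs => rw [← hπ]
    simp only [PMF.bind_apply, ← ENNReal.tsum_mul_left, ← ENNReal.tsum_mul_right]
    rw [ENNReal.tsum_comm]
    exact tsum_congr fun a => tsum_congr fun b => by ring
  have hstep : ∀ d : S → ℝ≥0∞, ∑' i, π i * taboo P j d i + π j * d j = ∑' i, π i * d i := by
    intro d
    rw [← hinv d]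
    simp only [tsum_mul_eq_taboo_add P j, mul_add, ENNReal.tsum_add]
    congr 1
    simp only [← mul_assoc, ENNReal.tsum_mul_right]
    congr 1
    conv_lhs => rw [← hπ]
    rw [PMF.bind_apply]
  set d : S → ℝ≥0∞ := fun s => if s = k then 1 else 0
  have hsum : ∀ h : ℕ, ∑' i, π i * (taboo P j)^[h] d i
      + π j * ∑ n ∈ Finset.range h, (taboo P j)^[n] d j = π k := by
    intro h
    induction h with
    | zero => simp [d]
    | succ h ih =>
      rw [Finset.sum_range_succ, mul_add, ← ih, ← hstep ((taboo P j)^[h] d),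
        Function.iterate_succ_apply']
      ring
  -- Dominated convergence against `π`: the iterates are bounded by the survival probabilities P(T >
  -- h).
  have hlim : Tendsto (fun h : ℕ => ∑' i, π i * (taboo P j)^[h] d i) atTop (𝓝 0) := by
    let _ : MeasurableSpace S := ⊤
    have hle : ∀ h i, (taboo P j)^[h] d i ≤ excess P j 0 h i := by
      intro h i
      rw [← taboo_iterate_excess]
      refine taboo_iterate_mono P j (fun s => ?_) h i
      rw [h0]
      simp only [d]; split_ifs <;> simp
    have hlim2 : Tendsto (fun h : ℕ => ∫⁻ i, π i * excess P j 0 h i ∂Measure.count) atTop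
        (𝓝 (∫⁻ _ : S, 0 ∂Measure.count)) := by
      refine tendsto_lintegral_of_dominated_convergence (fun i => π i)
        (fun n => measurable_from_top) (fun n => ?_) ?_ ?_
      · refine ae_of_all _ fun i => mul_le_of_le_one_right' ?_
        exact (excess_le_zero 0 n i).trans (h0 i).le
      · rw [lintegral_count, PMF.tsum_coe]; exact ENNReal.one_ne_top
      · refine ae_of_all _ fun i => ?_
        have := ENNReal.Tendsto.const_mul (a := π i)
          (tendsto_excess (P := P) (j := j) (p := 0) (i := i) (by rw [h0]; simp))
          (Or.inr (PMF.apply_ne_top π i))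
        simpa using this
    simp only [lintegral_count, tsum_zero] at hlim2
    exact tendsto_of_tendsto_of_tendsto_of_le_of_le tendsto_const_nhds hlim2
      (fun _ => zero_le) fun h => ENNReal.tsum_le_tsum fun i => mul_le_mul_right (hle h i) _
  have hl2 : Tendsto (fun h : ℕ => π j * ∑ n ∈ Finset.range h, (taboo P j)^[n] d j) atTop
      (𝓝 (π j * occupation P j j k)) :=
    ENNReal.Tendsto.const_mul
      (ENNReal.summable (f := fun n => (taboo P j)^[n] d j)).hasSum.tendsto_sum_nat
      (Or.inr (PMF.apply_ne_top π j))
  have hl := hlim.add hl2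
  simp only [hsum, zero_add] at hl
  exact tendsto_nhds_unique tendsto_const_nhds hl

end Taboo

end MarkovChain

namespace MarkovChain

/-! ### Real-valued cycle sums and their Poisson equations -/

section CycleSum

theorem tsum_toReal_comp {S : Type v} {a : S → ℝ≥0∞} {κ : S → S → ℝ≥0∞} {d : S → ℝ} {K : ℝ}
    (h : ∑' i, ∑' k, a i * κ i k ≠ ⊤) (hd : ∀ k, |d k| ≤ K) :
    ∑' k, (∑' i, a i * κ i k).toReal * d k
      = ∑' i, (a i).toReal * ∑' k, (κ i k).toReal * d k := by
  have hs : Summable fun p : S × S => (a p.1 * κ p.1 p.2).toReal := by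
    refine ENNReal.summable_toReal ?_
    rwa [ENNReal.tsum_prod (f := fun i k => a i * κ i k)]
  have hs2 : Summable fun p : S × S => (a p.1 * κ p.1 p.2).toReal * d p.2 := by
    refine Summable.of_norm_bounded (hs.mul_right K) fun p => ?_
    rw [norm_mul, Real.norm_of_nonneg ENNReal.toReal_nonneg]
    exact mul_le_mul_of_nonneg_left (hd p.2) ENNReal.toReal_nonneg
  have hfin : ∀ i k, a i * κ i k ≠ ⊤ := fun i k =>
    ENNReal.ne_top_of_tsum_ne_top (ENNReal.ne_top_of_tsum_ne_top h i) k
  calc _ = ∑' k, ∑' i, (a i * κ i k).toReal * d k := by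
        refine tsum_congr fun k => ?_
        rw [ENNReal.tsum_toReal_eq fun i => hfin i k, tsum_mul_right]
    _ = ∑' i, ∑' k, (a i * κ i k).toReal * d k :=
        (hs2.tsum_comm (f := fun i k => (a i * κ i k).toReal * d k))
    _ = _ := by
        refine tsum_congr fun i => ?_
        rw [← tsum_mul_left]
        exact tsum_congr fun k => by rw [ENNReal.toReal_mul, mul_assoc]

/-- The function `d`, set to zero at `j`. -/
noncomputable def killed {S : Type v} {β : Type*} [Zero β] (j : S) (d : S → β) : S → β :=
  Set.indicator {j}ᶜ d

@[simp]
theorem killed_self {S : Type v} {β : Type*} [Zero β] (j : S) (d : S → β) : killed j d j = 0 := by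
  simp [killed]

theorem killed_of_ne {S : Type v} {β : Type*} [Zero β] {j s : S} (d : S → β) (h : s ≠ j) :
    killed j d s = d s := by
  simp [killed, h]

/-- Expected sum of `d` along the chain started in `i`, over the times strictly before the first
passage to `j`. -/
noncomputable def cycleSum {S : Type v} (P : S → PMF S) (j : S) (d : S → ℝ) (i : S) : ℝ :=
  ∑' k, (occupation P j i k).toReal * d k

/-- `p`-th moment of the first passage time to `j`, as a real number. -/
noncomputable def passageMoment {S : Type v} (P : S → PMF S) (j : S) (p : ℕ) (i : S) : ℝ :=
  (excess P j p 0 i).toReal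

variable {S : Type v} {P : S → PMF S} {j : S}

theorem passageMoment_nonneg (p : ℕ) (i : S) : 0 ≤ passageMoment P j p i :=
  ENNReal.toReal_nonneg

section

variable (H : ∀ i, hittingMoment P 2 i j < ⊤)
include H

theorem excess_zero_eq_one_of_hittingMoment (i : S) : excess P j 0 0 i = 1 :=
  excess_zero_zero_eq_one (H i)

theorem excess_two_ne_top (i : S) : excess P j 2 0 i ≠ ⊤ := by
  rw [← hittingMoment_eq_excess (excess_zero_eq_one_of_hittingMoment H i)]
  exact (H i).ne

theorem excess_one_ne_top (i : S) : excess P j 1 0 i ≠ ⊤ :=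
  ne_top_of_le_ne_top (excess_two_ne_top H i) (excess_mono_moment one_le_two i)

theorem meanReturn_eq_passageMoment : meanReturn P j = passageMoment P j 1 j := by
  rw [meanReturn, hittingMoment_eq_excess (excess_zero_eq_one_of_hittingMoment H j)]
  rfl

theorem secondReturn_eq_passageMoment : secondReturn P j = passageMoment P j 2 j := by
  rw [secondReturn, hittingMoment_eq_excess (excess_zero_eq_one_of_hittingMoment H j)]
  rfl

theorem one_le_passageMoment_one (i : S) : 1 ≤ passageMoment P j 1 i := by
  have := ENNReal.toReal_mono (excess_one_ne_top H i) (excess_mono_moment zero_le_one i)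
  rwa [excess_zero_eq_one_of_hittingMoment H, ENNReal.toReal_one] at this

theorem passageMoment_one_le_two (i : S) : passageMoment P j 1 i ≤ passageMoment P j 2 i :=
  ENNReal.toReal_mono (excess_two_ne_top H i) (excess_mono_moment one_le_two i)

/-- The variance of the passage time is nonnegative; its law has total mass one because the passage
is almost surely finite. -/
theorem sq_passageMoment_one_le (i : S) :
    passageMoment P j 1 i ^ 2 ≤ passageMoment P j 2 i := by
  set μ := passageMoment P j 1 i
  have hs : ∀ p, excess P j p 0 i ≠ ⊤ →
      HasSum (fun n : ℕ => ((n : ℝ) + 1) ^ p * (firstPassage P j (n + 1) i).toReal)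
        (passageMoment P j p i) := by
    intro p hp
    have := ENNReal.hasSum_toReal hp
    unfold passageMoment excess
    rw [ENNReal.tsum_toReal_eq (fun n => ENNReal.ne_top_of_tsum_ne_top hp n)]
    convert this using 2 with n
    rw [ENNReal.toReal_mul, ENNReal.toReal_pow, ENNReal.toReal_natCast]
    simp
  have e0 := hs 0 (by rw [excess_zero_eq_one_of_hittingMoment H]; simp)
  have e1 := hs 1 (excess_one_ne_top H i)
  have e2 := hs 2 (excess_two_ne_top H i)
  have hp0 : passageMoment P j 0 i = 1 := by
    rw [passageMoment, excess_zero_eq_one_of_hittingMoment H]; simp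
  have := (e2.sub (e1.mul_left (2 * μ))).add (e0.mul_left (μ ^ 2))
  have hnn := this.nonneg fun n => by
    have h := mul_nonneg (sq_nonneg ((n : ℝ) + 1 - μ))
      (ENNReal.toReal_nonneg (a := firstPassage P j (n + 1) i))
    nlinarith [h]
  rw [hp0] at hnn
  change 0 ≤ passageMoment P j 2 i - 2 * μ * μ + μ ^ 2 * 1 at hnn
  nlinarith

theorem hasSum_occupation (i : S) :
    HasSum (fun k => (occupation P j i k).toReal) (passageMoment P j 1 i) := by
  have h := tsum_occupation_eq (excess_zero_eq_one_of_hittingMoment H) (excess_one_ne_top H i)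
  have h2 : ∑' k, occupation P j i k ≠ ⊤ := by rw [h]; exact excess_one_ne_top H i
  have := ENNReal.hasSum_toReal h2
  rwa [← ENNReal.tsum_toReal_eq fun n => ENNReal.ne_top_of_tsum_ne_top h2 n, h] at this

theorem summable_occupation_mul {d : S → ℝ} {K : ℝ} (hd : ∀ k, |d k| ≤ K) (i : S) :
    Summable fun k => (occupation P j i k).toReal * d k := by
  refine Summable.of_norm_bounded ((hasSum_occupation H i).summable.mul_right K) fun k => ?_
  rw [norm_mul, Real.norm_of_nonneg ENNReal.toReal_nonneg]
  exact mul_le_mul_of_nonneg_left (hd k) ENNReal.toReal_nonneg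

theorem abs_cycleSum_le {d : S → ℝ} {K : ℝ} (hd : ∀ k, |d k| ≤ K) (i : S) :
    |cycleSum P j d i| ≤ K * passageMoment P j 1 i := by
  rw [mul_comm, ← Real.norm_eq_abs]
  refine tsum_of_norm_bounded ((hasSum_occupation H i).mul_right K) fun k => ?_
  rw [norm_mul, Real.norm_of_nonneg ENNReal.toReal_nonneg]
  exact mul_le_mul_of_nonneg_left (hd k) ENNReal.toReal_nonneg

theorem cycleSum_mono {d d' : S → ℝ} {K K' : ℝ} (hd : ∀ k, |d k| ≤ K) (hd' : ∀ k, |d' k| ≤ K')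
    (h : ∀ k, d k ≤ d' k) (i : S) : cycleSum P j d i ≤ cycleSum P j d' i :=
  Summable.tsum_le_tsum (fun k => mul_le_mul_of_nonneg_left (h k) ENNReal.toReal_nonneg)
    (summable_occupation_mul H hd i) (summable_occupation_mul H hd' i)

theorem cycleSum_add {d d' : S → ℝ} {K K' : ℝ} (hd : ∀ k, |d k| ≤ K) (hd' : ∀ k, |d' k| ≤ K')
    (i : S) : cycleSum P j (fun k => d k + d' k) i = cycleSum P j d i + cycleSum P j d' i := by
  simp only [cycleSum, mul_add]
  exact (summable_occupation_mul H hd i).tsum_add (summable_occupation_mul H hd' i)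

theorem abs_cycleSum_sub_le {d d' : S → ℝ} {K' C : ℝ} (hd' : ∀ k, |d' k| ≤ K')
    (h : ∀ k, |d k - d' k| ≤ C) (i : S) :
    |cycleSum P j d i - cycleSum P j d' i| ≤ C * passageMoment P j 1 i := by
  have h1 : cycleSum P j d i - cycleSum P j d' i = cycleSum P j (fun k => d k - d' k) i := by
    have := cycleSum_add H hd' h i
    simp only [add_sub_cancel] at this
    linarith
  rw [h1]
  exact abs_cycleSum_le H h i

omit H in
theorem cycleSum_const_mul (c : ℝ) (d : S → ℝ) (i : S) :
    cycleSum P j (fun k => c * d k) i = c * cycleSum P j d i := by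
  simp only [cycleSum, ← tsum_mul_left]
  exact tsum_congr fun k => by ring

theorem cycleSum_sum {ι : Type*} (s : Finset ι) {d : ι → S → ℝ} {K : ι → ℝ}
    (hd : ∀ n k, |d n k| ≤ K n) (i : S) :
    cycleSum P j (fun k => ∑ n ∈ s, d n k) i = ∑ n ∈ s, cycleSum P j (d n) i := by
  simp only [cycleSum, Finset.mul_sum]
  exact Summable.tsum_finsetSum fun n _ => summable_occupation_mul H (hd n) i

/-- Poisson equation with source `d`: after the first step, the sum continues only if `j` was
missed. Boundedness of `d` and the finite mean passage time justify the exchange of sums. -/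
theorem cycleSum_eq {d : S → ℝ} {K : ℝ} (hd : ∀ k, |d k| ≤ K) (i : S) :
    cycleSum P j d i
      = d i + ∑' k, (P i k).toReal * killed j (cycleSum P j d) k := by
  classical
  set a : S → ℝ≥0∞ := fun k => if k = j then 0 else P i k with ha
  have hocc : ∀ k, occupation P j i k = (if i = k then 1 else 0) + ∑' l, a l * occupation P j l k :=
    fun k => by rw [occupation_eq]; rfl
  have htot : ∑' l, ∑' k, a l * occupation P j l k ≠ ⊤ := by
    have h1 : ∑' l, ∑' k, a l * occupation P j l k = taboo P j (excess P j 1 0) i := by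
      simp only [ENNReal.tsum_mul_left]
      refine tsum_congr fun l => ?_
      rw [tsum_occupation_eq (excess_zero_eq_one_of_hittingMoment H) (excess_one_ne_top H l)]
    rw [h1]
    refine ne_top_of_le_ne_top (excess_one_ne_top H i) ?_
    rw [excess_one_eq i]
    exact le_add_self
  have htot2 : ∀ k, ∑' l, a l * occupation P j l k ≠ ⊤ := by
    rw [ENNReal.tsum_comm] at htot
    exact fun k => ENNReal.ne_top_of_tsum_ne_top htot k
  have hreal : ∀ k, (occupation P j i k).toReal * d k
      = (if i = k then d i else 0) + (∑' l, a l * occupation P j l k).toReal * d k := by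
    intro k
    rw [hocc k, ENNReal.toReal_add (by split_ifs <;> simp) (htot2 k)]
    by_cases h : i = k
    · subst h; simp [add_mul]
    · simp [h]
  have hsum1 : HasSum (fun k => if i = k then d i else 0) (d i) := by
    have := hasSum_ite_eq (i) (d i) (SummationFilter.unconditional S)
    convert this using 2 with k
    simp [eq_comm]
  have hsum2 : Summable fun k => (∑' l, a l * occupation P j l k).toReal * d k := by
    have := (summable_occupation_mul H hd i).sub hsum1.summable
    refine this.congr fun k => ?_
    rw [hreal k]; ring
  rw [cycleSum, tsum_congr hreal, hsum1.summable.tsum_add hsum2, hsum1.tsum_eq,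
    tsum_toReal_comp htot hd]
  congr 1
  refine tsum_congr fun l => ?_
  by_cases h : l = j
  · simp [ha, h]
  · simp [ha, h, cycleSum, killed_of_ne]

/-- Kac's formula: summing `π k = π j * occupation P j j k` over `k` identifies `π j` as the
reciprocal of the mean return time. -/
theorem cycleSum_eq_mul_stationary {π : PMF S} (hπ : π.bind P = π) (d : S → ℝ) :
    cycleSum P j d j = passageMoment P j 1 j * ∑' k, (π k).toReal * d k := by
  have h := stationary_eq_mul_occupation hπ (excess_zero_eq_one_of_hittingMoment H)
  have h1 : 1 = (π j).toReal * passageMoment P j 1 j := by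
    have h2 : (1 : ℝ≥0∞) = π j * excess P j 1 0 j := by
      rw [← PMF.tsum_coe π, tsum_congr h, ENNReal.tsum_mul_left,
        tsum_occupation_eq (excess_zero_eq_one_of_hittingMoment H) (excess_one_ne_top H j)]
    have := congrArg ENNReal.toReal h2
    rwa [ENNReal.toReal_one, ENNReal.toReal_mul] at this
  have h3 : ∑' k, (π k).toReal * d k = (π j).toReal * cycleSum P j d j := by
    rw [cycleSum, ← tsum_mul_left]
    refine tsum_congr fun k => ?_
    rw [h k, ENNReal.toReal_mul, mul_assoc]
  rw [h3, ← mul_assoc, mul_comm (passageMoment P j 1 j), ← h1, one_mul]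

theorem taboo_excess_one_toReal (i : S) :
    (taboo P j (excess P j 1 0) i).toReal = passageMoment P j 1 i - 1 := by
  have h := excess_one_eq (P := P) (j := j) i
  have hne : taboo P j (excess P j 1 0) i ≠ ⊤ :=
    ne_top_of_le_ne_top (excess_one_ne_top H i) (h ▸ le_add_self)
  rw [excess_zero_eq_one_of_hittingMoment H] at h
  rw [passageMoment, h, ENNReal.toReal_add ENNReal.one_ne_top hne]
  simp

theorem taboo_excess_ne_top {p : ℕ} (hp : p = 1 ∨ p = 2) (i : S) :
    taboo P j (excess P j p 0) i ≠ ⊤ := by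
  rcases hp with rfl | rfl
  · exact ne_top_of_le_ne_top (excess_one_ne_top H i) (excess_one_eq i ▸ le_add_self)
  · exact ne_top_of_le_ne_top (excess_two_ne_top H i) (excess_two_eq i ▸ le_add_self)

theorem tsum_mul_killed_passageMoment {p : ℕ} (hp : p = 1 ∨ p = 2) (i : S) :
    ∑' k, (P i k).toReal * killed j (passageMoment P j p) k
      = (taboo P j (excess P j p 0) i).toReal := by
  classical
  have hne := taboo_excess_ne_top H hp i
  unfold taboo at hne ⊢
  rw [ENNReal.tsum_toReal_eq fun k => ENNReal.ne_top_of_tsum_ne_top hne k]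
  refine tsum_congr fun k => ?_
  by_cases h : k = j
  · subst h; simp
  · simp [h, killed_of_ne, passageMoment]

theorem tsum_mul_killed_passageMoment_one (i : S) :
    ∑' k, (P i k).toReal * killed j (passageMoment P j 1) k = passageMoment P j 1 i - 1 := by
  rw [tsum_mul_killed_passageMoment H (Or.inl rfl), taboo_excess_one_toReal H]

/-- The left side is E[(T − 1)²], the case T = 1 contributing nothing. -/
theorem tsum_mul_killed_passageMoment_two (i : S) :
    ∑' k, (P i k).toReal * killed j (passageMoment P j 2) k
      = passageMoment P j 2 i - 2 * passageMoment P j 1 i + 1 := by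
  rw [tsum_mul_killed_passageMoment H (Or.inr rfl)]
  have h := congrArg ENNReal.toReal (excess_two_eq (P := P) (j := j) i)
  rw [excess_zero_eq_one_of_hittingMoment H, ENNReal.toReal_add (ENNReal.add_ne_top.2
    ⟨ENNReal.one_ne_top, ENNReal.mul_ne_top (by simp) (taboo_excess_ne_top H (Or.inl rfl) i)⟩)
    (taboo_excess_ne_top H (Or.inr rfl) i), ENNReal.toReal_add ENNReal.one_ne_top
    (ENNReal.mul_ne_top (by simp) (taboo_excess_ne_top H (Or.inl rfl) i)), ENNReal.toReal_mul,
    taboo_excess_one_toReal H] at h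
  change passageMoment P j 2 i = _ at h
  rw [h]
  simp
  ring

end

theorem tsum_mul_killed (P : S → PMF S) (d : S → ℝ≥0∞) (i : S) :
    ∑' k, P i k * killed j d k = taboo P j d i := by
  classical
  unfold taboo
  refine tsum_congr fun k => ?_
  by_cases h : k = j
  · subst h; simp
  · simp [h, killed_of_ne]

end CycleSum

end MarkovChain

/-! ### The Markov property along a policy -/

theorem measurable_comp_of_countable {Ω : Type*} {S : Type*} {β : Type*} [Countable S]
    [MeasurableSpace β] {m : MeasurableSpace Ω} {st : Ω → S}
    (hst : ∀ s, MeasurableSet[m] {ω | st ω = s}) {h : S → Ω → β} (hh : ∀ s, Measurable[m] (h s)) :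
    Measurable[m] fun ω => h (st ω) ω := by
  intro B hB
  have : (fun ω => h (st ω) ω) ⁻¹' B = ⋃ s, {ω | st ω = s} ∩ h s ⁻¹' B := by
    ext ω; simp
  rw [this]
  exact MeasurableSet.iUnion fun s => (hst s).inter (hh s hB)

namespace StochasticNetwork.Policy

open MarkovChain

variable {S : Type v} [Countable S] {X : Type w} [TopologicalSpace X] [MeasurableSpace X] {r : ℕ}
  {N : StochasticNetwork S X r} {s₀ : S} (pol : Policy.{u} N s₀)

omit [Countable S] in
theorem measurableSet_state (t : ℕ) (s : S) : MeasurableSet {ω | pol.state t ω = s} :=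
  pol.ℱ.le t _ (pol.state_adapted t s)

theorem measurable_state_comp {β : Type*} [MeasurableSpace β] (t : ℕ) (h : S → β) :
    Measurable[pol.ℱ t] fun ω => h (pol.state t ω) :=
  measurable_comp_of_countable (pol.state_adapted t) fun _ => measurable_const

theorem measurable_state_comp' {β : Type*} [MeasurableSpace β] (t : ℕ) (h : S → β) :
    Measurable fun ω => h (pol.state t ω) :=
  (pol.measurable_state_comp t h).mono (pol.ℱ.le t) le_rfl

omit [Countable S] in
theorem pairwise_disjoint_state (t : ℕ) :
    Pairwise (Function.onFun Disjoint fun s => {ω | pol.state t ω = s}) := by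
  intro a b hab
  rw [Function.onFun, Set.disjoint_left]
  intro ω h1 h2
  exact hab (h1.symm.trans h2)

omit [Countable S] in
theorem iUnion_state (t : ℕ) : ⋃ s, {ω | pol.state t ω = s} = Set.univ := by
  ext ω; simp

/-- The Markov property as an equality of measures on `ℱ t`: there, the event of moving to `k` has
density P(S(t), k). The hypothesis `markov` is summed over the countably many values of S(t). -/
theorem trim_restrict_next (t : ℕ) (k : S) :
    (pol.ℙ.restrict {ω | pol.state (t + 1) ω = k}).trim (pol.ℱ.le t)
      = (pol.ℙ.withDensity fun ω => N.P (pol.state t ω) k).trim (pol.ℱ.le t) := by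
  refine @Measure.ext _ (pol.ℱ t) _ _ fun E hE => ?_
  have hE' : MeasurableSet E := pol.ℱ.le t _ hE
  rw [trim_measurableSet_eq _ hE, trim_measurableSet_eq _ hE, Measure.restrict_apply hE',
    withDensity_apply _ hE']
  have h1 : E ∩ {ω | pol.state (t + 1) ω = k}
      = ⋃ i, E ∩ {ω | pol.state t ω = i} ∩ {ω | pol.state (t + 1) ω = k} := by
    ext ω; simp
  have h2 : E = ⋃ i, E ∩ {ω | pol.state t ω = i} := by
    ext ω; simp
  have hd : Pairwise (Function.onFun Disjoint fun i => E ∩ {ω | pol.state t ω = i}) :=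
    fun a b hab => (pol.pairwise_disjoint_state t hab).mono Set.inter_subset_right
      Set.inter_subset_right
  rw [h1, measure_iUnion (fun a b hab => (hd hab).mono Set.inter_subset_left
    Set.inter_subset_left) fun i => (hE'.inter (pol.measurableSet_state t i)).inter
      (pol.measurableSet_state (t + 1) k)]
  conv_rhs => rw [h2]
  rw [lintegral_iUnion (fun i => hE'.inter (pol.measurableSet_state t i)) hd]
  refine tsum_congr fun i => ?_
  rw [pol.markov t E hE i k]
  have : ∫⁻ ω in E ∩ {ω | pol.state t ω = i}, N.P (pol.state t ω) k ∂pol.ℙ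
      = ∫⁻ _ in E ∩ {ω | pol.state t ω = i}, N.P i k ∂pol.ℙ := by
    refine setLIntegral_congr_fun (hE'.inter (pol.measurableSet_state t i)) ?_
    rintro ω ⟨-, h⟩
    simp only [Set.mem_ofPred_eq] at h
    simp only [h]
  rw [this, setLIntegral_const, mul_comm]

theorem setLIntegral_next (t : ℕ) (k : S) {Z : pol.Ω → ℝ≥0∞} (hZ : Measurable[pol.ℱ t] Z) :
    ∫⁻ ω in {ω | pol.state (t + 1) ω = k}, Z ω ∂pol.ℙ
      = ∫⁻ ω, N.P (pol.state t ω) k * Z ω ∂pol.ℙ := by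
  rw [← lintegral_trim (pol.ℱ.le t) hZ, trim_restrict_next, lintegral_trim (pol.ℱ.le t) hZ,
    lintegral_withDensity_eq_lintegral_mul _ (pol.measurable_state_comp' t fun s => N.P s k)
      (hZ.mono (pol.ℱ.le t) le_rfl)]
  rfl

theorem setIntegral_next (t : ℕ) (k : S) {Z : pol.Ω → ℝ} (hZ : Measurable[pol.ℱ t] Z) :
    ∫ ω in {ω | pol.state (t + 1) ω = k}, Z ω ∂pol.ℙ
      = ∫ ω, (N.P (pol.state t ω) k).toReal * Z ω ∂pol.ℙ := by
  rw [integral_trim (pol.ℱ.le t) hZ.stronglyMeasurable, trim_restrict_next,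
    ← integral_trim (pol.ℱ.le t) hZ.stronglyMeasurable,
    integral_withDensity_eq_integral_toReal_smul (pol.measurable_state_comp' t fun s => N.P s k)
      (ae_of_all _ fun ω => PMF.apply_lt_top _ _)]
  rfl

theorem lintegral_next (t : ℕ) (h : S → ℝ≥0∞) :
    ∫⁻ ω, h (pol.state (t + 1) ω) ∂pol.ℙ
      = ∫⁻ ω, ∑' k, N.P (pol.state t ω) k * h k ∂pol.ℙ := by
  rw [← setLIntegral_univ, ← pol.iUnion_state (t + 1),
    lintegral_iUnion (pol.measurableSet_state (t + 1)) (pol.pairwise_disjoint_state (t + 1)),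
    lintegral_tsum fun k =>
      (pol.measurable_state_comp' t fun s => N.P s k * h k).aemeasurable]
  refine tsum_congr fun k => ?_
  rw [← pol.setLIntegral_next t k measurable_const]
  refine setLIntegral_congr_fun (pol.measurableSet_state (t + 1) k) ?_
  rintro ω hω
  simp only [Set.mem_ofPred_eq] at hω
  simp only [hω]

/-- The integrand may depend on the past as well as on the next state. This lets a potential be
advanced by one step while the random backlogs stay at their time `t` value. -/
theorem integral_next (t : ℕ) {Y : S → pol.Ω → ℝ} (hY : ∀ k, Measurable[pol.ℱ t] (Y k))
    (hint : Integrable (fun ω => Y (pol.state (t + 1) ω) ω) pol.ℙ) :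
    ∫ ω, Y (pol.state (t + 1) ω) ω ∂pol.ℙ
      = ∫ ω, ∑' k, (N.P (pol.state t ω) k).toReal * Y k ω ∂pol.ℙ := by
  have hms := pol.measurableSet_state (t + 1)
  have hdj := pol.pairwise_disjoint_state (t + 1)
  have hcongr : ∀ (k : S) (g : ℝ → ℝ),
      ∫ ω in {ω | pol.state (t + 1) ω = k}, g (Y (pol.state (t + 1) ω) ω) ∂pol.ℙ
      = ∫ ω in {ω | pol.state (t + 1) ω = k}, g (Y k ω) ∂pol.ℙ := by
    intro k g
    refine setIntegral_congr_fun (hms k) fun ω hω => ?_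
    simp only [Set.mem_ofPred_eq] at hω
    simp only [hω]
  have hs : ∀ g : ℝ → ℝ, Integrable (fun ω => g (Y (pol.state (t + 1) ω) ω)) pol.ℙ →
      Measurable g →
      HasSum (fun k => ∫ ω, (N.P (pol.state t ω) k).toReal * g (Y k ω) ∂pol.ℙ)
        (∫ ω, g (Y (pol.state (t + 1) ω) ω) ∂pol.ℙ) := by
    intro g hg hgm
    have := hasSum_integral_iUnion (μ := pol.ℙ) hms hdj hg.integrableOn
    rw [pol.iUnion_state, setIntegral_univ] at this
    have he : ∀ k, ∫ ω in {ω | pol.state (t + 1) ω = k}, g (Y (pol.state (t + 1) ω) ω) ∂pol.ℙ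
        = ∫ ω, (N.P (pol.state t ω) k).toReal * g (Y k ω) ∂pol.ℙ := fun k => by
      rw [hcongr k g]
      exact pol.setIntegral_next t k (hgm.comp (hY k))
    simp only [he] at this
    exact this
  have hsY := hs id hint measurable_id
  have hsN := hs norm hint.norm measurable_norm
  have hnorm : ∀ k ω, ‖(N.P (pol.state t ω) k).toReal * Y k ω‖
      = (N.P (pol.state t ω) k).toReal * ‖Y k ω‖ := fun k ω => by
    rw [norm_mul, Real.norm_of_nonneg ENNReal.toReal_nonneg]
  have hYk : ∀ k, IntegrableOn (Y k) {ω | pol.state (t + 1) ω = k} pol.ℙ := by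
    intro k
    refine (integrableOn_congr_fun (fun ω hω => ?_) (hms k)).1
      (hint.integrableOn (s := {ω | pol.state (t + 1) ω = k}))
    simp only [Set.mem_ofPred_eq] at hω
    simp only [hω]
  have hik : ∀ k, Integrable (fun ω => (N.P (pol.state t ω) k).toReal * Y k ω) pol.ℙ := by
    intro k
    have hm : Measurable fun ω => (N.P (pol.state t ω) k).toReal * Y k ω :=
      (pol.measurable_state_comp' t fun s => (N.P s k).toReal).mul
        ((hY k).mono (pol.ℱ.le t) le_rfl)
    refine ⟨hm.aestronglyMeasurable, ?_⟩
    have h1 := (hYk k).2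
    unfold HasFiniteIntegral at h1 ⊢
    rw [pol.setLIntegral_next t k (Z := fun ω => ‖Y k ω‖ₑ) (measurable_enorm.comp (hY k))] at h1
    refine lt_of_eq_of_lt (lintegral_congr fun ω => ?_) h1
    rw [enorm_mul, ← ofReal_norm, Real.norm_of_nonneg ENNReal.toReal_nonneg,
      ENNReal.ofReal_toReal (PMF.apply_ne_top _ _)]
  have hsum := hasSum_integral_of_summable_integral_norm hik (by
    simp only [hnorm]; exact hsN.summable)
  exact hsY.unique hsum

/-- Expectation of a function of the state. -/
noncomputable def stateMean (t : ℕ) (d : S → ℝ) : ℝ := ∫ ω, d (pol.state t ω) ∂pol.ℙ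

/-- Probability that the network is in the state `s` at time `t`. -/
noncomputable def visitProb (s : S) (t : ℕ) : ℝ := pol.ℙ.real {ω | pol.state t ω = s}

/-! ### Long run behaviour of the remaining passage time -/

variable {s₁ : S}

/-- Finite at the deterministic start, and each step adds at most the second moment of the return
time to `s₁`. -/
theorem lintegral_excess_two_lt_top (H : ∀ i, hittingMoment N.P 2 i s₁ < ⊤) (t : ℕ) :
    ∫⁻ ω, excess N.P s₁ 2 0 (pol.state t ω) ∂pol.ℙ < ⊤ := by
  induction t with
  | zero =>
    have : ∫⁻ ω, excess N.P s₁ 2 0 (pol.state 0 ω) ∂pol.ℙ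
        = ∫⁻ _, excess N.P s₁ 2 0 s₀ ∂pol.ℙ := by
      refine lintegral_congr_ae ?_
      filter_upwards [pol.initial] with ω h
      rw [h]
    rw [this]
    simpa using (excess_two_ne_top H s₀).lt_top
  | succ t ih =>
    rw [lintegral_next]
    have hb : ∀ ω, ∑' k, N.P (pol.state t ω) k * excess N.P s₁ 2 0 k
        ≤ excess N.P s₁ 2 0 (pol.state t ω) + excess N.P s₁ 2 0 s₁ := by
      intro ω
      rw [tsum_mul_eq_taboo_add N.P s₁]
      refine add_le_add ?_ (mul_le_of_le_one_left' (PMF.coe_le_one _ _))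
      conv_rhs => rw [excess_two_eq]
      exact le_add_self
    refine lt_of_le_of_lt (lintegral_mono hb) ?_
    rw [lintegral_add_right _ measurable_const]
    refine ENNReal.add_lt_top.2 ⟨ih, ?_⟩
    simpa using (excess_two_ne_top H s₁).lt_top

/-- Last exit decomposition: either `s₁` has not been visited, or its last visit was some number of
steps ago; the probability of that visit is bounded by one. -/
theorem lintegral_killed_excess_le (n h : ℕ) :
    ∫⁻ ω, killed s₁ (excess N.P s₁ 2 h) (pol.state n ω) ∂pol.ℙ
      ≤ excess N.P s₁ 2 (n + h) s₀ + ∑ a ∈ Finset.range n, excess N.P s₁ 2 (a + h + 1) s₁ := by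
  have hk : ∀ d : S → ℝ≥0∞, ∀ s, killed s₁ d s ≤ d s := fun d s =>
    Set.indicator_le_self _ _ _
  induction n generalizing h with
  | zero =>
    have : ∫⁻ ω, killed s₁ (excess N.P s₁ 2 h) (pol.state 0 ω) ∂pol.ℙ
        = ∫⁻ _, killed s₁ (excess N.P s₁ 2 h) s₀ ∂pol.ℙ := by
      refine lintegral_congr_ae ?_
      filter_upwards [pol.initial] with ω h
      rw [h]
    rw [this]
    simpa using hk _ _
  | succ n ih =>
    rw [lintegral_next]
    have hb : ∀ ω, ∑' k, N.P (pol.state n ω) k * killed s₁ (excess N.P s₁ 2 h) k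
        ≤ killed s₁ (excess N.P s₁ 2 (h + 1)) (pol.state n ω) + excess N.P s₁ 2 (h + 1) s₁ := by
      intro ω
      rw [tsum_mul_killed, taboo_excess]
      by_cases hs : pol.state n ω = s₁
      · rw [hs]; exact le_add_self
      · rw [killed_of_ne _ hs]; exact le_self_add
    refine (lintegral_mono hb).trans ?_
    rw [lintegral_add_right _ measurable_const]
    refine (add_le_add (ih (h + 1)) le_rfl).trans ?_
    rw [Finset.sum_range_succ', add_assoc]
    simp only [lintegral_const, measure_univ, mul_one]
    refine add_le_add (le_of_eq (by ring_nf)) (add_le_add (le_of_eq ?_) (le_of_eq (by ring_nf)))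
    exact Finset.sum_congr rfl fun a _ => by ring_nf

section

variable (H : ∀ i, hittingMoment N.P 2 i s₁ < ⊤)
include H

theorem integrable_passageMoment {p : ℕ} (hp : p = 1 ∨ p = 2) (t : ℕ) :
    Integrable (fun ω => passageMoment N.P s₁ p (pol.state t ω)) pol.ℙ := by
  have h2 : Integrable (fun ω => passageMoment N.P s₁ 2 (pol.state t ω)) pol.ℙ :=
    integrable_toReal_of_lintegral_ne_top (pol.measurable_state_comp' t _).aemeasurable
      (pol.lintegral_excess_two_lt_top H t).ne
  rcases hp with rfl | rfl
  · refine h2.mono' (pol.measurable_state_comp' t _).aestronglyMeasurable (ae_of_all _ fun ω => ?_)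
    rw [Real.norm_of_nonneg (passageMoment_nonneg _ _)]
    exact passageMoment_one_le_two H _
  · exact h2

omit H in
theorem integrable_killed {d : S → ℝ} (t : ℕ)
    (h : Integrable (fun ω => d (pol.state t ω)) pol.ℙ) :
    Integrable (fun ω => killed s₁ d (pol.state t ω)) pol.ℙ := by
  refine h.mono (pol.measurable_state_comp' t _).aestronglyMeasurable (ae_of_all _ fun ω => ?_)
  exact norm_indicator_le_norm_self _ _

omit H in
theorem stateMean_eq_killed_add (t : ℕ) {d : S → ℝ}
    (h : Integrable (fun ω => d (pol.state t ω)) pol.ℙ) :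
    pol.stateMean t d = pol.stateMean t (killed s₁ d) + d s₁ * pol.visitProb s₁ t := by
  have h1 : ∀ ω, d (pol.state t ω) = killed s₁ d (pol.state t ω)
      + Set.indicator {ω | pol.state t ω = s₁} (fun _ => d s₁) ω := by
    intro ω
    by_cases hs : pol.state t ω = s₁
    · have hm : ω ∈ {ω | pol.state t ω = s₁} := hs
      rw [Set.indicator_of_mem hm, hs]; simp
    · have hm : ω ∉ {ω | pol.state t ω = s₁} := hs
      rw [Set.indicator_of_notMem hm, killed_of_ne _ hs, add_zero]
  have hk : Integrable (fun ω => killed s₁ d (pol.state t ω)) pol.ℙ :=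
    h.mono (pol.measurable_state_comp' t _).aestronglyMeasurable
      (ae_of_all _ fun ω => norm_indicator_le_norm_self _ _)
  unfold stateMean
  rw [integral_congr_ae (ae_of_all _ h1), integral_add hk
    ((integrable_const _).indicator (pol.measurableSet_state t s₁)),
    integral_indicator_const _ (pol.measurableSet_state t s₁)]
  simp [visitProb, mul_comm]

/-- Mean remaining time to the next visit of `s₁` (zero in `s₁`). -/
theorem stateMean_passage_one_succ (t : ℕ) :
    pol.stateMean (t + 1) (killed s₁ (passageMoment N.P s₁ 1))
      = pol.stateMean t (killed s₁ (passageMoment N.P s₁ 1))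
        + meanReturn N.P s₁ * pol.visitProb s₁ t - 1 := by
  have hi := pol.integrable_passageMoment H (Or.inl rfl) t
  have h := pol.integral_next t (Y := fun k _ => killed s₁ (passageMoment N.P s₁ 1) k)
    (fun _ => measurable_const)
    (pol.integrable_killed (t + 1) (pol.integrable_passageMoment H (Or.inl rfl) (t + 1)))
  simp only [tsum_mul_killed_passageMoment_one H] at h
  rw [integral_sub hi (integrable_const _)] at h
  have h2 := pol.stateMean_eq_killed_add (s₁ := s₁) t hi
  unfold stateMean at h2 ⊢
  rw [h, h2, meanReturn_eq_passageMoment H]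
  simp

/-- The second moment Poisson equation. Its cross term is the mean remaining passage time, so
summing over `t` computes the long run average of the latter. -/
theorem stateMean_passage_two_succ (t : ℕ) :
    pol.stateMean (t + 1) (killed s₁ (passageMoment N.P s₁ 2))
      = pol.stateMean t (killed s₁ (passageMoment N.P s₁ 2))
        + secondReturn N.P s₁ * pol.visitProb s₁ t
        - 2 * pol.stateMean (t + 1) (killed s₁ (passageMoment N.P s₁ 1)) - 1 := by
  have hi := pol.integrable_passageMoment H (Or.inl rfl) t
  have hi2 := pol.integrable_passageMoment H (Or.inr rfl) t
  have h := pol.integral_next t (Y := fun k _ => killed s₁ (passageMoment N.P s₁ 2) k)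
    (fun _ => measurable_const)
    (pol.integrable_killed (t + 1) (pol.integrable_passageMoment H (Or.inr rfl) (t + 1)))
  simp only [tsum_mul_killed_passageMoment_two H] at h
  have hsplit : ∫ ω, (passageMoment N.P s₁ 2 (pol.state t ω)
      - 2 * passageMoment N.P s₁ 1 (pol.state t ω) + 1) ∂pol.ℙ
      = ∫ ω, passageMoment N.P s₁ 2 (pol.state t ω) ∂pol.ℙ
        - 2 * ∫ ω, passageMoment N.P s₁ 1 (pol.state t ω) ∂pol.ℙ + 1 := by
    rw [integral_add (f := fun ω => passageMoment N.P s₁ 2 (pol.state t ω)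
      - 2 * passageMoment N.P s₁ 1 (pol.state t ω)) (hi2.sub (hi.const_mul 2))
      (integrable_const _), integral_sub hi2 (hi.const_mul 2), integral_const_mul]
    simp
  rw [hsplit] at h
  have h1 := pol.stateMean_eq_killed_add (s₁ := s₁) t hi
  have h2 := pol.stateMean_eq_killed_add (s₁ := s₁) t hi2
  have h3 := pol.stateMean_passage_one_succ H t
  rw [meanReturn_eq_passageMoment H] at h3
  rw [secondReturn_eq_passageMoment H]
  unfold stateMean at h1 h2 h3 ⊢
  rw [h, h2, h3, h1]
  ring

theorem tendsto_stateMean_passage_two :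
    Tendsto (fun n : ℕ => (n : ℝ)⁻¹ * pol.stateMean n (killed s₁ (passageMoment N.P s₁ 2)))
      atTop (𝓝 0) := by
  have hb : ∀ n : ℕ, pol.stateMean n (killed s₁ (passageMoment N.P s₁ 2))
      ≤ (excess N.P s₁ 2 n s₀).toReal
        + ∑ a ∈ Finset.range n, (excess N.P s₁ 2 (a + 1) s₁).toReal := by
    intro n
    have h1 : pol.stateMean n (killed s₁ (passageMoment N.P s₁ 2))
        = (∫⁻ ω, killed s₁ (excess N.P s₁ 2 0) (pol.state n ω) ∂pol.ℙ).toReal := by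
      rw [← integral_toReal (pol.measurable_state_comp' n _).aemeasurable
        (ae_of_all _ fun ω => ?_)]
      · refine integral_congr_ae (ae_of_all _ fun ω => ?_)
        by_cases h : pol.state n ω = s₁
        · simp [h]
        · simp [killed_of_ne _ h, passageMoment]
      · by_cases h : pol.state n ω = s₁
        · simp [h]
        · rw [killed_of_ne _ h]; exact (excess_two_ne_top H _).lt_top
    have hne : ∀ a ∈ Finset.range n, excess N.P s₁ 2 (a + 1) s₁ ≠ ⊤ := fun a _ =>
      ne_top_of_le_ne_top (excess_two_ne_top H s₁) (excess_le_zero 2 _ _)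
    have hne0 : excess N.P s₁ 2 n s₀ ≠ ⊤ :=
      ne_top_of_le_ne_top (excess_two_ne_top H s₀) (excess_le_zero 2 _ _)
    rw [h1, ← ENNReal.toReal_sum hne, ← ENNReal.toReal_add hne0 (ENNReal.sum_ne_top.2 hne)]
    exact ENNReal.toReal_mono (ENNReal.add_ne_top.2 ⟨hne0, ENNReal.sum_ne_top.2 hne⟩)
      (pol.lintegral_killed_excess_le n 0)
  have hreal : ∀ s, Tendsto (fun n : ℕ => (excess N.P s₁ 2 n s).toReal) atTop (𝓝 0) := by
    intro s
    have := (ENNReal.tendsto_toReal ENNReal.zero_ne_top).comp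
      (tendsto_excess (excess_two_ne_top H s))
    simpa [Function.comp_def] using this
  -- The sum over the last exit is n times a Cesàro mean of a null sequence, so the bound is o(n),
  -- though it need not be bounded.
  have hlim := (tendsto_inv_atTop_nhds_zero_nat (𝕜 := ℝ)).mul (hreal s₀) |>.add
    (((hreal s₁).comp (tendsto_add_atTop_nat 1)).cesaro)
  simp only [mul_zero, add_zero] at hlim
  refine tendsto_of_tendsto_of_tendsto_of_le_of_le tendsto_const_nhds hlim (fun n => ?_) fun n => ?_
  · exact mul_nonneg (by positivity) (integral_nonneg fun ω =>
      Set.indicator_nonneg (fun s _ => passageMoment_nonneg 2 s) _)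
  · rw [← mul_add]
    exact mul_le_mul_of_nonneg_left (hb n) (by positivity)

omit [Countable S] H in
theorem stateMean_passage_one_nonneg (t : ℕ) :
    0 ≤ pol.stateMean t (killed s₁ (passageMoment N.P s₁ 1)) :=
  integral_nonneg fun _ => Set.indicator_nonneg (fun s _ => passageMoment_nonneg 1 s) _

theorem tendsto_stateMean_passage_one :
    Tendsto (fun n : ℕ => (n : ℝ)⁻¹ * pol.stateMean n (killed s₁ (passageMoment N.P s₁ 1)))
      atTop (𝓝 0) := by
  refine tendsto_of_tendsto_of_tendsto_of_le_of_le tendsto_const_nhds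
    (pol.tendsto_stateMean_passage_two H) (fun n => ?_) fun n => ?_
  · exact mul_nonneg (by positivity) (pol.stateMean_passage_one_nonneg n)
  · refine mul_le_mul_of_nonneg_left ?_ (by positivity)
    refine integral_mono (pol.integrable_killed n (pol.integrable_passageMoment H (Or.inl rfl) n))
      (pol.integrable_killed n (pol.integrable_passageMoment H (Or.inr rfl) n)) fun ω => ?_
    exact Set.indicator_le_indicator (passageMoment_one_le_two H _)

omit [Countable S] in
theorem meanReturn_pos : 0 < meanReturn N.P s₁ := by
  rw [meanReturn_eq_passageMoment H]
  exact one_pos.trans_le (one_le_passageMoment_one H s₁)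

/-- Long run frequency of the visits to `s₁`. -/
theorem tendsto_visitProb :
    Tendsto (fun n : ℕ => (n : ℝ)⁻¹ * ∑ t ∈ Finset.range n, pol.visitProb s₁ t) atTop
      (𝓝 (meanReturn N.P s₁)⁻¹) := by
  have hT := meanReturn_pos H
  set T := meanReturn N.P s₁
  set a := fun n => pol.stateMean n (killed s₁ (passageMoment N.P s₁ 1))
  have hsum : ∀ n : ℕ, T * ∑ t ∈ Finset.range n, pol.visitProb s₁ t = n + a n - a 0 := by
    intro n
    induction n with
    | zero => simp
    | succ n ih =>
      have := pol.stateMean_passage_one_succ H n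
      rw [Finset.sum_range_succ, mul_add, ih]
      push_cast
      simp only [a]
      linarith
  have h0 := tendsto_inv_atTop_nhds_zero_nat (𝕜 := ℝ)
  have hlim : Tendsto (fun n : ℕ => T⁻¹ * (1 + (n : ℝ)⁻¹ * a n - (n : ℝ)⁻¹ * a 0)) atTop
      (𝓝 (T⁻¹ * (1 + 0 - 0 * a 0))) :=
    ((tendsto_const_nhds.add (pol.tendsto_stateMean_passage_one H)).sub
      (h0.mul_const _)).const_mul _
  simp only [add_zero, zero_mul, sub_zero, mul_one] at hlim
  refine hlim.congr' ?_
  filter_upwards [eventually_gt_atTop 0] with n hn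
  have hn' : (n : ℝ) ≠ 0 := by positivity
  have := hsum n
  field_simp
  linarith

/-- The mean residual life of renewal theory: dividing the summed recursion by n, the boundary terms
vanish and the visit frequency 1/T leaves (T₂/T − 1)/2, with T₂ the second moment. -/
theorem tendsto_average_passage :
    Tendsto (fun n : ℕ => (n : ℝ)⁻¹ * ∑ t ∈ Finset.range n,
      pol.stateMean (t + 1) (killed s₁ (passageMoment N.P s₁ 1))) atTop
      (𝓝 (N.constD s₁ / (2 * meanReturn N.P s₁))) := by
  have hT := meanReturn_pos H
  set a := fun n => pol.stateMean n (killed s₁ (passageMoment N.P s₁ 1))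
  set b := fun n => pol.stateMean n (killed s₁ (passageMoment N.P s₁ 2))
  have hsum : ∀ n : ℕ, 2 * ∑ t ∈ Finset.range n, a (t + 1)
      = b 0 - b n + secondReturn N.P s₁ * ∑ t ∈ Finset.range n, pol.visitProb s₁ t - n := by
    intro n
    induction n with
    | zero => simp
    | succ n ih =>
      have := pol.stateMean_passage_two_succ H n
      rw [Finset.sum_range_succ, Finset.sum_range_succ, mul_add, mul_add, ih]
      push_cast
      simp only [a, b]
      linarith
  have h0 := tendsto_inv_atTop_nhds_zero_nat (𝕜 := ℝ)
  have hlim := ((((h0.mul_const (b 0)).sub (pol.tendsto_stateMean_passage_two H)).add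
    ((pol.tendsto_visitProb H).const_mul (secondReturn N.P s₁))).sub
      (tendsto_const_nhds (x := (1 : ℝ)))).const_mul (1 / 2)
  have hval : 1 / 2 * (0 * b 0 - 0 + secondReturn N.P s₁ * (meanReturn N.P s₁)⁻¹ - 1)
      = N.constD s₁ / (2 * meanReturn N.P s₁) := by
    rw [constD]; field_simp; ring
  rw [hval] at hlim
  refine hlim.congr' ?_
  filter_upwards [eventually_gt_atTop 0] with n hn
  have hn' : (n : ℝ) ≠ 0 := by positivity
  have := hsum n
  field_simp
  simp only [a, b] at this ⊢
  linarith

end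

end StochasticNetwork.Policy

/-! ### Minimal weights and the cycle weight for frozen backlogs -/

theorem continuous_of_abs_sub_le_sum {r : ℕ} {f : (Fin r → ℝ) → ℝ} {C : ℝ}
    (h : ∀ q q', |f q - f q'| ≤ C * ∑ j, |q j - q' j|) : Continuous f := by
  refine continuous_iff_continuousAt.2 fun q' => ?_
  rw [ContinuousAt, tendsto_iff_dist_tendsto_zero]
  have hc : Continuous fun q : Fin r → ℝ => C * ∑ j, |q j - q' j| := by fun_prop
  have h0 := hc.tendsto q'
  simp only [sub_self, abs_zero, Finset.sum_const_zero, mul_zero] at h0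
  exact squeeze_zero (fun _ => dist_nonneg) (fun q => by rw [Real.dist_eq]; exact h q q') h0

namespace StochasticNetwork

open MarkovChain

section Weight

variable {S : Type v} {X : Type w} [TopologicalSpace X] [MeasurableSpace X] {r : ℕ}
  (N : StochasticNetwork S X r)

/-- The quantity minimized by MaxWeight with backlogs `q`. -/
noncomputable def weight (V : ℝ) (q : Fin r → ℝ) (s : S) (x : X) : ℝ :=
  V * N.cost s x + ∑ j, q j * (N.traffic j s x - N.service j s x)

/-- The smallest weight of a feasible action. -/
noncomputable def minWeight (V : ℝ) (q : Fin r → ℝ) (s : S) : ℝ :=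
  sInf (N.weight V q s '' N.feasible s)

variable {N}

theorem abs_traffic_sub_service_le {s : S} {x : X} (hx : x ∈ N.feasible s) (j : Fin r) :
    |N.traffic j s x - N.service j s x| ≤ N.deltaMax := by
  have h1 := N.traffic_nonneg j s x hx
  have h2 := N.service_nonneg j s x hx
  have h3 := N.traffic_le j s x hx
  have h4 := N.service_le j s x hx
  rw [abs_le]; constructor <;> linarith

theorem abs_weight_sub_le {V : ℝ} {s : S} {x : X} (hx : x ∈ N.feasible s) (q q' : Fin r → ℝ) :
    |N.weight V q s x - N.weight V q' s x| ≤ N.deltaMax * ∑ j, |q j - q' j| := by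
  have : N.weight V q s x - N.weight V q' s x
      = ∑ j, (q j - q' j) * (N.traffic j s x - N.service j s x) := by
    simp only [weight, add_sub_add_left_eq_sub, ← Finset.sum_sub_distrib]
    exact Finset.sum_congr rfl fun j _ => by ring
  rw [this, Finset.mul_sum]
  refine (Finset.abs_sum_le_sum_abs _ _).trans (Finset.sum_le_sum fun j _ => ?_)
  rw [abs_mul, mul_comm]
  exact mul_le_mul_of_nonneg_right (abs_traffic_sub_service_le hx j) (abs_nonneg _)

theorem abs_weight_le {V : ℝ} (hV : 0 ≤ V) {s : S} {x : X} (hx : x ∈ N.feasible s)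
    (q : Fin r → ℝ) : |N.weight V q s x| ≤ N.deltaMax * (V + ∑ j, |q j|) := by
  have h1 := abs_weight_sub_le (V := V) hx q 0
  have h2 : |N.weight V 0 s x| ≤ N.deltaMax * V := by
    simp only [weight, Pi.zero_apply, zero_mul, Finset.sum_const_zero, add_zero, abs_mul,
      abs_of_nonneg hV]
    rw [mul_comm]
    exact mul_le_mul_of_nonneg_right (N.abs_cost_le s x hx) hV
  simp only [Pi.zero_apply, sub_zero] at h1
  have h3 := abs_add_le (N.weight V q s x - N.weight V 0 s x) (N.weight V 0 s x)
  rw [sub_add_cancel] at h3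
  linarith

theorem bddBelow_weight {V : ℝ} (hV : 0 ≤ V) (q : Fin r → ℝ) (s : S) :
    BddBelow (N.weight V q s '' N.feasible s) := by
  refine ⟨-(N.deltaMax * (V + ∑ j, |q j|)), ?_⟩
  rintro _ ⟨x, hx, rfl⟩
  exact (abs_le.1 (abs_weight_le hV hx q)).1

theorem minWeight_le {V : ℝ} (hV : 0 ≤ V) {s : S} {x : X} (hx : x ∈ N.feasible s)
    (q : Fin r → ℝ) : N.minWeight V q s ≤ N.weight V q s x :=
  csInf_le (bddBelow_weight hV q s) ⟨x, hx, rfl⟩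

theorem le_minWeight {V : ℝ} {q : Fin r → ℝ} {s : S} {c : ℝ} (hne : (N.feasible s).Nonempty)
    (h : ∀ x ∈ N.feasible s, c ≤ N.weight V q s x) : c ≤ N.minWeight V q s := by
  refine le_csInf (hne.image _) ?_
  rintro _ ⟨x, hx, rfl⟩
  exact h x hx

/-- An infimum of functions of `q` with a common Lipschitz constant. The resulting continuity also
makes the potentials measurable when evaluated at random backlogs. -/
theorem abs_minWeight_sub_le {V : ℝ} (hV : 0 ≤ V) {s : S} (hne : (N.feasible s).Nonempty)
    (q q' : Fin r → ℝ) :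
    |N.minWeight V q s - N.minWeight V q' s| ≤ N.deltaMax * ∑ j, |q j - q' j| := by
  have key : ∀ q q' : Fin r → ℝ,
      N.minWeight V q s - N.deltaMax * ∑ j, |q j - q' j| ≤ N.minWeight V q' s := by
    intro q q'
    refine le_minWeight hne fun x hx => ?_
    have h1 := minWeight_le hV hx q
    have h2 := (abs_le.1 (abs_weight_sub_le (V := V) hx q q')).2
    linarith
  have h1 := key q q'
  have h2 := key q' q
  simp only [abs_sub_comm (q' _) (q _)] at h2
  rw [abs_le]; constructor <;> linarith

theorem abs_minWeight_le {V : ℝ} (hV : 0 ≤ V) {s : S} (hne : (N.feasible s).Nonempty)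
    (q : Fin r → ℝ) : |N.minWeight V q s| ≤ N.deltaMax * (V + ∑ j, |q j|) := by
  obtain ⟨x, hx⟩ := hne
  have h1 := minWeight_le hV hx q
  have h2 := (abs_le.1 (abs_weight_le hV hx q)).2
  have h3 : -(N.deltaMax * (V + ∑ j, |q j|)) ≤ N.minWeight V q s :=
    le_minWeight ⟨x, hx⟩ fun y hy => (abs_le.1 (abs_weight_le hV hy q)).1
  rw [abs_le]; constructor <;> linarith

/-- Sum of the minimal weights over a passage to `s₁`, for frozen backlogs `q`. -/
noncomputable def passageWeight (N : StochasticNetwork S X r) (s₁ : S) (V : ℝ) (q : Fin r → ℝ) :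
    S → ℝ :=
  cycleSum N.P s₁ (N.minWeight V q)

section

variable {s₁ : S} (H : ∀ i, hittingMoment N.P 2 i s₁ < ⊤) (hne : ∀ s, (N.feasible s).Nonempty)
  {V : ℝ} (hV : 0 ≤ V)
include H hne hV

theorem abs_passageWeight_le (q : Fin r → ℝ) (s : S) :
    |N.passageWeight s₁ V q s|
      ≤ N.deltaMax * (V + ∑ j, |q j|) * passageMoment N.P s₁ 1 s :=
  abs_cycleSum_le H (fun k => abs_minWeight_le hV (hne k) q) s

theorem abs_passageWeight_sub_le (q q' : Fin r → ℝ) (s : S) :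
    |N.passageWeight s₁ V q s - N.passageWeight s₁ V q' s|
      ≤ N.deltaMax * (∑ j, |q j - q' j|) * passageMoment N.P s₁ 1 s :=
  abs_cycleSum_sub_le H (fun k => abs_minWeight_le hV (hne k) q')
    (fun k => abs_minWeight_sub_le hV (hne k) q q') s

theorem continuous_passageWeight (s : S) : Continuous fun q => N.passageWeight s₁ V q s := by
  refine continuous_of_abs_sub_le_sum (C := N.deltaMax * passageMoment N.P s₁ 1 s) fun q q' => ?_
  rw [mul_right_comm]
  exact abs_passageWeight_sub_le H hne hV q q' s

omit H in
theorem continuous_minWeight (s : S) : Continuous fun q => N.minWeight V q s :=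
  continuous_of_abs_sub_le_sum fun q q' => abs_minWeight_sub_le hV (hne s) q q'

/-- The Poisson equation that lets the one-slot minimal weights telescope. -/
theorem tsum_mul_killed_passageWeight (q : Fin r → ℝ) (s : S) :
    ∑' k, (N.P s k).toReal * killed s₁ (N.passageWeight s₁ V q) k
      = N.passageWeight s₁ V q s - N.minWeight V q s := by
  have := cycleSum_eq H (fun k => abs_minWeight_le hV (hne k) q) s
  unfold passageWeight
  linarith

end

theorem B_sq : N.B ^ 2 = r * N.deltaMax ^ 2 := by
  rw [B, mul_pow, Real.sq_sqrt (Nat.cast_nonneg r)]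

end Weight

/-! ### Pathwise queue estimates -/

namespace Policy

variable {S : Type v} {X : Type w} [TopologicalSpace X] [MeasurableSpace X] {r : ℕ}
  {N : StochasticNetwork S X r} {s₀ : S} (pol : Policy.{u} N s₀)

theorem ae_feasible : ∀ᵐ ω ∂pol.ℙ, ∀ t, pol.action t ω ∈ N.feasible (pol.state t ω) :=
  ae_all_iff.2 pol.action_feasible

variable {pol} in
theorem queue_bounds {ω : pol.Ω} (h : ∀ t, pol.action t ω ∈ N.feasible (pol.state t ω)) (t : ℕ)
    (j : Fin r) : 0 ≤ pol.queue t ω j ∧ pol.queue t ω j ≤ t * N.deltaMax := by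
  induction t with
  | zero => simp [queue]
  | succ t ih =>
    have h1 := N.traffic_nonneg j _ _ (h t)
    have h2 := N.service_nonneg j _ _ (h t)
    have h3 := N.traffic_le j _ _ (h t)
    refine ⟨add_nonneg (le_max_right _ _) h1, ?_⟩
    have : max (pol.queue t ω j - N.service j (pol.state t ω) (pol.action t ω)) 0
        ≤ t * N.deltaMax := max_le (by linarith) (ih.1.trans ih.2)
    rw [queue]
    push_cast
    linarith

variable {pol} in
theorem abs_queue_succ_sub_le {ω : pol.Ω}
    (h : ∀ t, pol.action t ω ∈ N.feasible (pol.state t ω)) (t : ℕ) (j : Fin r) :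
    |pol.queue (t + 1) ω j - pol.queue t ω j| ≤ N.deltaMax := by
  have h0 := (queue_bounds h t j).1
  have h1 := N.traffic_nonneg j _ _ (h t)
  have h2 := N.service_nonneg j _ _ (h t)
  have h3 := N.traffic_le j _ _ (h t)
  have h4 := N.service_le j _ _ (h t)
  rw [queue, abs_le]
  rcases max_cases (pol.queue t ω j - N.service j (pol.state t ω) (pol.action t ω)) 0
    with ⟨h, h'⟩ | ⟨h, h'⟩ <;> rw [h] <;> constructor <;> linarith

-- Dropping the truncation at zero turns traffic minus service into a backlog increment, which
-- telescopes in the weak duality argument.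
variable {pol} in
theorem queue_sub_le_queue_succ (t : ℕ) (ω : pol.Ω) (j : Fin r) :
    pol.queue t ω j + (N.traffic j (pol.state t ω) (pol.action t ω)
      - N.service j (pol.state t ω) (pol.action t ω)) ≤ pol.queue (t + 1) ω j := by
  rw [queue]
  have := le_max_left (pol.queue t ω j - N.service j (pol.state t ω) (pol.action t ω)) 0
  linarith

-- Expand the square, with (q − μ)⁺ ≤ q in the cross term and (q − μ)⁺² ≤ (q − μ)²; the remainder
-- A²/2 + μ²/2 is at most δ².
variable {pol} in
theorem queue_succ_sq_le {ω : pol.Ω}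
    (h : ∀ t, pol.action t ω ∈ N.feasible (pol.state t ω)) (t : ℕ) (j : Fin r) :
    1 / 2 * pol.queue (t + 1) ω j ^ 2 ≤ 1 / 2 * pol.queue t ω j ^ 2 + N.deltaMax ^ 2
      + pol.queue t ω j * (N.traffic j (pol.state t ω) (pol.action t ω)
        - N.service j (pol.state t ω) (pol.action t ω)) := by
  have h0 := (queue_bounds h t j).1
  have h1 := N.traffic_nonneg j _ _ (h t)
  have h2 := N.service_nonneg j _ _ (h t)
  have h3 := N.traffic_le j _ _ (h t)
  have h4 := N.service_le j _ _ (h t)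
  rw [queue]
  set q := pol.queue t ω j
  set A := N.traffic j (pol.state t ω) (pol.action t ω)
  set m := N.service j (pol.state t ω) (pol.action t ω)
  have hm : max (q - m) 0 ≤ q := max_le (by linarith) h0
  have hm0 : 0 ≤ max (q - m) 0 := le_max_right _ _
  have hsq : max (q - m) 0 ^ 2 ≤ (q - m) ^ 2 := by
    rcases max_cases (q - m) 0 with ⟨h, _⟩ | ⟨h, _⟩ <;> rw [h]
    nlinarith [sq_nonneg (q - m)]
  have hA : A ^ 2 ≤ N.deltaMax ^ 2 := pow_le_pow_left₀ h1 h3 2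
  have hM : m ^ 2 ≤ N.deltaMax ^ 2 := pow_le_pow_left₀ h2 h4 2
  nlinarith [mul_le_mul_of_nonneg_right hm h1]

variable {pol} in
theorem half_sum_queue_succ_sq_le {ω : pol.Ω}
    (h : ∀ t, pol.action t ω ∈ N.feasible (pol.state t ω)) (t : ℕ) (V : ℝ) :
    1 / 2 * ∑ j, pol.queue (t + 1) ω j ^ 2 + V * N.cost (pol.state t ω) (pol.action t ω)
      ≤ 1 / 2 * ∑ j, pol.queue t ω j ^ 2 + N.B ^ 2
        + N.weight V (pol.queue t ω) (pol.state t ω) (pol.action t ω) := by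
  have := Finset.sum_le_sum fun j (_ : j ∈ Finset.univ) => queue_succ_sq_le h t j
  simp only [Finset.sum_add_distrib, ← Finset.mul_sum, Finset.sum_const, Finset.card_univ,
    Fintype.card_fin, nsmul_eq_mul] at this
  rw [B_sq, weight]
  linarith

section Measurability

variable [Countable S]

theorem measurable_action_comp {g : S → X → ℝ} (hg : ∀ s, Measurable (g s)) (t : ℕ) :
    Measurable[pol.ℱ t] fun ω => g (pol.state t ω) (pol.action t ω) :=
  measurable_comp_of_countable (h := fun s ω => g s (pol.action t ω)) (pol.state_adapted t)
    fun s => (hg s).comp (pol.action_adapted t)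

theorem measurable_queue_apply (t : ℕ) (j : Fin r) :
    Measurable[pol.ℱ t] fun ω => pol.queue t ω j := by
  induction t with
  | zero => exact measurable_const
  | succ t ih =>
    refine Measurable.mono (ma := pol.ℱ t) ?_ (pol.ℱ.mono t.le_succ) le_rfl
    exact ((ih.sub (pol.measurable_action_comp (N.measurable_service j) t)).max
      measurable_const).add (pol.measurable_action_comp (N.measurable_traffic j) t)

theorem measurable_queue (t : ℕ) : Measurable[pol.ℱ t] (pol.queue t) :=
  @measurable_pi_lambda _ _ _ (pol.ℱ t) _ _ fun j => pol.measurable_queue_apply t j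

end Measurability

end Policy

end StochasticNetwork

/-! ### Expected drift inequalities and their sums -/

namespace StochasticNetwork.Policy

open MarkovChain

variable {S : Type v} [Countable S] {X : Type w} [TopologicalSpace X] [MeasurableSpace X] {r : ℕ}
  {N : StochasticNetwork S X r} {s₀ : S} (pol : Policy.{u} N s₀)

/-- Expected cost of slot `t`. -/
noncomputable def meanCost (t : ℕ) : ℝ := ∫ ω, N.cost (pol.state t ω) (pol.action t ω) ∂pol.ℙ

/-- Expected quadratic Lyapunov function. -/
noncomputable def lyapunov (t : ℕ) : ℝ := ∫ ω, 1 / 2 * ∑ j, pol.queue t ω j ^ 2 ∂pol.ℙ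

/-- Expected total backlog. -/
noncomputable def meanBacklog (t : ℕ) : ℝ := ∫ ω, ∑ j, pol.queue t ω j ∂pol.ℙ

/-- Expected total weight until the next visit of `s₁`, for frozen backlogs. -/
noncomputable def weightPotential (s₁ : S) (V : ℝ) (t : ℕ) : ℝ :=
  ∫ ω, killed s₁ (N.passageWeight s₁ V (pol.queue t ω)) (pol.state t ω) ∂pol.ℙ

/-- Expected weight of a full cycle with frozen backlogs, on the event that the network is in
`s₁`. -/
noncomputable def visitWeight (s₁ : S) (V : ℝ) (t : ℕ) : ℝ :=
  ∫ ω, Set.indicator {ω | pol.state t ω = s₁}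
    (fun ω => N.passageWeight s₁ V (pol.queue t ω) s₁) ω ∂pol.ℙ

/-- Expected total backlog on the event that the network is in `s₁`. -/
noncomputable def visitBacklog (s₁ : S) (t : ℕ) : ℝ :=
  ∫ ω, Set.indicator {ω | pol.state t ω = s₁} (fun ω => ∑ j, pol.queue t ω j) ω ∂pol.ℙ

/-- Expected product of the total backlog and the mean remaining time to the next visit of `s₁`. -/
noncomputable def backlogPotential (s₁ : S) (t : ℕ) : ℝ :=
  ∫ ω, (∑ j, pol.queue t ω j) * killed s₁ (passageMoment N.P s₁ 1) (pol.state t ω) ∂pol.ℙ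

theorem measurable_queue_apply' (t : ℕ) (j : Fin r) : Measurable fun ω => pol.queue t ω j :=
  (pol.measurable_queue_apply t j).mono (pol.ℱ.le t) le_rfl

theorem measurable_queue' (t : ℕ) : Measurable (pol.queue t) :=
  (pol.measurable_queue t).mono (pol.ℱ.le t) le_rfl

theorem measurable_totalBacklog (t : ℕ) :
    Measurable[pol.ℱ t] fun ω => ∑ j, pol.queue t ω j :=
  Finset.measurable_fun_sum _ fun j _ => pol.measurable_queue_apply t j

theorem measurable_totalBacklog' (t : ℕ) : Measurable fun ω => ∑ j, pol.queue t ω j :=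
  (pol.measurable_totalBacklog t).mono (pol.ℱ.le t) le_rfl

omit [Countable S] in
variable {pol} in
theorem totalBacklog_bounds {ω : pol.Ω}
    (h : ∀ t, pol.action t ω ∈ N.feasible (pol.state t ω)) (t : ℕ) :
    0 ≤ ∑ j, pol.queue t ω j ∧ ∑ j, pol.queue t ω j ≤ r * (t * N.deltaMax) := by
  refine ⟨Finset.sum_nonneg fun j _ => (queue_bounds h t j).1, ?_⟩
  have := Finset.sum_le_sum fun j (_ : j ∈ Finset.univ) => (queue_bounds h t j).2
  simpa using this

theorem integrable_totalBacklog (t : ℕ) :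
    Integrable (fun ω => ∑ j, pol.queue t ω j) pol.ℙ := by
  refine Integrable.of_bound (pol.measurable_totalBacklog' t).aestronglyMeasurable
    (r * (t * N.deltaMax)) ?_
  filter_upwards [pol.ae_feasible] with ω h
  rw [Real.norm_of_nonneg (totalBacklog_bounds h t).1]
  exact (totalBacklog_bounds h t).2

theorem integrable_queue (t : ℕ) (j : Fin r) :
    Integrable (fun ω => pol.queue t ω j) pol.ℙ := by
  refine Integrable.of_bound (pol.measurable_queue_apply' t j).aestronglyMeasurable
    (t * N.deltaMax) ?_
  filter_upwards [pol.ae_feasible] with ω h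
  rw [Real.norm_of_nonneg (queue_bounds h t j).1]
  exact (queue_bounds h t j).2

theorem meanBacklog_eq (t : ℕ) : pol.meanBacklog t = ∑ j, ∫ ω, pol.queue t ω j ∂pol.ℙ :=
  integral_finsetSum _ fun j _ => pol.integrable_queue t j

theorem integrable_half_sum_queue_sq (t : ℕ) :
    Integrable (fun ω => 1 / 2 * ∑ j, pol.queue t ω j ^ 2) pol.ℙ := by
  have hm : Measurable fun ω => 1 / 2 * ∑ j, pol.queue t ω j ^ 2 :=
    (Finset.measurable_fun_sum _ fun j _ => (pol.measurable_queue_apply' t j).pow_const 2).const_mul _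
  refine Integrable.of_bound hm.aestronglyMeasurable (1 / 2 * (r * (t * N.deltaMax) ^ 2)) ?_
  filter_upwards [pol.ae_feasible] with ω h
  rw [Real.norm_of_nonneg (by positivity)]
  refine mul_le_mul_of_nonneg_left ?_ (by norm_num)
  have := Finset.sum_le_sum fun j (_ : j ∈ Finset.univ) =>
    pow_le_pow_left₀ (queue_bounds h t j).1 (queue_bounds h t j).2 2
  simpa using this

theorem integrable_cost (t : ℕ) :
    Integrable (fun ω => N.cost (pol.state t ω) (pol.action t ω)) pol.ℙ := by
  refine Integrable.of_bound ((pol.measurable_action_comp N.measurable_cost t).mono (pol.ℱ.le t)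
    le_rfl).aestronglyMeasurable N.deltaMax ?_
  filter_upwards [pol.ae_feasible] with ω h
  exact N.abs_cost_le _ _ (h t)

variable {s₁ : S}

section

variable (H : ∀ i, hittingMoment N.P 2 i s₁ < ⊤)
include H

theorem integrable_of_ae_abs_le_mul_passageMoment (t : ℕ) {f : pol.Ω → ℝ} (hf : Measurable f)
    (K : ℝ) (h : ∀ᵐ ω ∂pol.ℙ, |f ω| ≤ K * passageMoment N.P s₁ 1 (pol.state t ω)) :
    Integrable f pol.ℙ :=
  ((pol.integrable_passageMoment H (Or.inl rfl) t).const_mul K).mono' hf.aestronglyMeasurable h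

omit [Countable S] H in
theorem abs_killed_le (d : S → ℝ) (s : S) : |killed s₁ d s| ≤ |d s| :=
  norm_indicator_le_norm_self d s

omit H in
theorem measurable_totalBacklog_mul (d : S → ℝ) (t t' : ℕ) :
    Measurable fun ω => (∑ j, pol.queue t ω j) * d (pol.state t' ω) :=
  (pol.measurable_totalBacklog' t).mul (pol.measurable_state_comp' t' d)

theorem integrable_totalBacklog_mul {d : S → ℝ}
    (hd : ∀ s, |d s| ≤ passageMoment N.P s₁ 1 s) (t t' : ℕ) :
    Integrable (fun ω => (∑ j, pol.queue t ω j) * d (pol.state t' ω)) pol.ℙ := by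
  refine pol.integrable_of_ae_abs_le_mul_passageMoment H t' (pol.measurable_totalBacklog_mul d t t')
    (r * (t * N.deltaMax)) ?_
  filter_upwards [pol.ae_feasible] with ω h
  have hb := totalBacklog_bounds h t
  rw [abs_mul, abs_of_nonneg hb.1]
  exact mul_le_mul hb.2 (hd _) (abs_nonneg _) (hb.1.trans hb.2)

omit [Countable S] H in
theorem backlogPotential_nonneg (t : ℕ) : 0 ≤ pol.backlogPotential s₁ t := by
  refine integral_nonneg_of_ae ?_
  filter_upwards [pol.ae_feasible] with ω h
  exact mul_nonneg (totalBacklog_bounds h t).1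
    (Set.indicator_nonneg (fun s _ => passageMoment_nonneg 1 s) _)

/-- Product rule for total backlog times mean remaining passage time: the second factor drops by one
per slot on average, gains a mean return time at each visit to `s₁`, and the backlog grows by at
most r δ. -/
theorem meanBacklog_le (t : ℕ) :
    pol.meanBacklog t ≤ meanReturn N.P s₁ * pol.visitBacklog s₁ t + pol.backlogPotential s₁ t
      - pol.backlogPotential s₁ (t + 1)
      + r * N.deltaMax * pol.stateMean (t + 1) (killed s₁ (passageMoment N.P s₁ 1)) := by
  have hm1 : ∀ s, |passageMoment N.P s₁ 1 s| ≤ passageMoment N.P s₁ 1 s := fun s =>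
    (abs_of_nonneg (passageMoment_nonneg 1 s)).le
  have hk1 : ∀ s, |killed s₁ (passageMoment N.P s₁ 1) s| ≤ passageMoment N.P s₁ 1 s := fun s =>
    (abs_killed_le _ s).trans (hm1 s)
  have hnext := pol.integral_next t
    (Y := fun k ω => (∑ j, pol.queue t ω j) * killed s₁ (passageMoment N.P s₁ 1) k)
    (fun k => (pol.measurable_totalBacklog t).mul_const _)
    (pol.integrable_totalBacklog_mul H hk1 t (t + 1))
  have hpt : ∀ ω, ∑' k, (N.P (pol.state t ω) k).toReal
      * ((∑ j, pol.queue t ω j) * killed s₁ (passageMoment N.P s₁ 1) k)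
      = (∑ j, pol.queue t ω j) * killed s₁ (passageMoment N.P s₁ 1) (pol.state t ω)
        + meanReturn N.P s₁ * Set.indicator {ω | pol.state t ω = s₁}
          (fun ω => ∑ j, pol.queue t ω j) ω - ∑ j, pol.queue t ω j := by
    intro ω
    simp only [mul_left_comm _ (∑ j, pol.queue t ω j), tsum_mul_left,
      tsum_mul_killed_passageMoment_one H, meanReturn_eq_passageMoment H]
    by_cases h : pol.state t ω = s₁
    · have hm : ω ∈ {ω | pol.state t ω = s₁} := h
      rw [Set.indicator_of_mem hm, h, killed_self]; ring
    · have hm : ω ∉ {ω | pol.state t ω = s₁} := h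
      rw [Set.indicator_of_notMem hm, killed_of_ne _ h]; ring
  simp only [hpt] at hnext
  have hi1 := pol.integrable_totalBacklog_mul H hk1 t t
  have hi2 : Integrable (fun ω => meanReturn N.P s₁ * Set.indicator {ω | pol.state t ω = s₁}
      (fun ω => ∑ j, pol.queue t ω j) ω) pol.ℙ :=
    ((pol.integrable_totalBacklog t).indicator (pol.measurableSet_state t s₁)).const_mul _
  rw [integral_sub (hi1.fun_add hi2) (pol.integrable_totalBacklog t), integral_add hi1 hi2,
    integral_const_mul] at hnext
  have hstep : pol.backlogPotential s₁ (t + 1)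
      ≤ ∫ ω, (∑ j, pol.queue t ω j) * killed s₁ (passageMoment N.P s₁ 1)
          (pol.state (t + 1) ω) ∂pol.ℙ
        + r * N.deltaMax * pol.stateMean (t + 1) (killed s₁ (passageMoment N.P s₁ 1)) := by
    have hi3 := pol.integrable_totalBacklog_mul H hk1 t (t + 1)
    have hi4 := (pol.integrable_killed (s₁ := s₁) (t + 1)
      (pol.integrable_passageMoment H (Or.inl rfl) (t + 1))).const_mul (r * N.deltaMax)
    rw [stateMean, ← integral_const_mul, ← integral_add hi3 hi4]
    refine integral_mono_ae (pol.integrable_totalBacklog_mul H hk1 (t + 1) (t + 1))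
      (hi3.fun_add hi4) ?_
    filter_upwards [pol.ae_feasible] with ω h
    have h1 : ∑ j, pol.queue (t + 1) ω j ≤ ∑ j, pol.queue t ω j + r * N.deltaMax := by
      have := Finset.sum_le_sum fun j (_ : j ∈ Finset.univ) =>
        (abs_le.1 (abs_queue_succ_sub_le h t j)).2
      simp only [Finset.sum_sub_distrib, Finset.sum_const, Finset.card_univ, Fintype.card_fin,
        nsmul_eq_mul] at this
      linarith
    have h2 : 0 ≤ killed s₁ (passageMoment N.P s₁ 1) (pol.state (t + 1) ω) :=
      Set.indicator_nonneg (fun s _ => passageMoment_nonneg 1 s) _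
    have := mul_le_mul_of_nonneg_right h1 h2
    rw [add_mul] at this
    exact this
  unfold meanBacklog visitBacklog
  unfold backlogPotential at hstep ⊢
  linarith

variable (hne : ∀ s, (N.feasible s).Nonempty) {V : ℝ} (hV : 0 ≤ V)
include hne hV

omit [Countable S] in
theorem continuous_killed_passageWeight (s : S) :
    Continuous fun q => killed s₁ (N.passageWeight s₁ V q) s := by
  by_cases h : s = s₁
  · subst h; simpa using continuous_const
  · simpa only [killed_of_ne _ h] using continuous_passageWeight H hne hV s

theorem integrable_killed_passageWeight (t t' : ℕ) :
    Integrable (fun ω => killed s₁ (N.passageWeight s₁ V (pol.queue t ω)) (pol.state t' ω))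
      pol.ℙ := by
  refine pol.integrable_of_ae_abs_le_mul_passageMoment H t'
    (measurable_comp_of_countable (h := fun s ω =>
      killed s₁ (N.passageWeight s₁ V (pol.queue t ω)) s) (pol.measurableSet_state t')
      fun s => (continuous_killed_passageWeight H hne hV s).measurable.comp
        (pol.measurable_queue' t)) (N.deltaMax * (V + r * (t * N.deltaMax))) ?_
  filter_upwards [pol.ae_feasible] with ω h
  refine (abs_killed_le _ _).trans ((abs_passageWeight_le H hne hV _ _).trans ?_)
  refine mul_le_mul_of_nonneg_right (mul_le_mul_of_nonneg_left ?_ N.deltaMax_pos.le)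
    (passageMoment_nonneg 1 _)
  have : ∑ j, |pol.queue t ω j| = ∑ j, pol.queue t ω j :=
    Finset.sum_congr rfl fun j _ => abs_of_nonneg (queue_bounds h t j).1
  rw [this]
  linarith [(totalBacklog_bounds h t).2]

theorem integrable_indicator_passageWeight (t : ℕ) :
    Integrable (Set.indicator {ω | pol.state t ω = s₁}
      (fun ω => N.passageWeight s₁ V (pol.queue t ω) s₁)) pol.ℙ := by
  refine Integrable.indicator ?_ (pol.measurableSet_state t s₁)
  refine Integrable.of_bound ((continuous_passageWeight H hne hV s₁).measurable.comp
    (pol.measurable_queue' t)).aestronglyMeasurable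
    (N.deltaMax * (V + r * (t * N.deltaMax)) * passageMoment N.P s₁ 1 s₁) ?_
  filter_upwards [pol.ae_feasible] with ω h
  refine (abs_passageWeight_le H hne hV _ _).trans ?_
  refine mul_le_mul_of_nonneg_right (mul_le_mul_of_nonneg_left ?_ N.deltaMax_pos.le)
    (passageMoment_nonneg 1 _)
  have : ∑ j, |pol.queue t ω j| = ∑ j, pol.queue t ω j :=
    Finset.sum_congr rfl fun j _ => abs_of_nonneg (queue_bounds h t j).1
  rw [this]
  linarith [(totalBacklog_bounds h t).2]

omit H in
theorem integrable_minWeight_queue (t : ℕ) :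
    Integrable (fun ω => N.minWeight V (pol.queue t ω) (pol.state t ω)) pol.ℙ := by
  have hm : Measurable fun ω => N.minWeight V (pol.queue t ω) (pol.state t ω) :=
    measurable_comp_of_countable (h := fun s ω => N.minWeight V (pol.queue t ω) s)
      (pol.measurableSet_state t) fun s => (continuous_minWeight hne hV s).measurable.comp
        (pol.measurable_queue' t)
  refine Integrable.of_bound hm.aestronglyMeasurable
    (N.deltaMax * (V + r * (t * N.deltaMax))) ?_
  filter_upwards [pol.ae_feasible] with ω h
  refine (abs_minWeight_le hV (hne _) _).trans ?_
  refine mul_le_mul_of_nonneg_left ?_ N.deltaMax_pos.le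
  have : ∑ j, |pol.queue t ω j| = ∑ j, pol.queue t ω j :=
    Finset.sum_congr rfl fun j _ => abs_of_nonneg (queue_bounds h t j).1
  rw [this]
  linarith [(totalBacklog_bounds h t).2]

omit H in
theorem lyapunov_succ_le (hqla : pol.IsQLA V) (t : ℕ) :
    pol.lyapunov (t + 1) + V * pol.meanCost t ≤ pol.lyapunov t + N.B ^ 2
      + ∫ ω, N.minWeight V (pol.queue t ω) (pol.state t ω) ∂pol.ℙ := by
  have hi1 := pol.integrable_half_sum_queue_sq (t + 1)
  have hi2 := (pol.integrable_cost t).const_mul V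
  have hi3 := (pol.integrable_half_sum_queue_sq t).fun_add (integrable_const (N.B ^ 2))
  have hi4 := pol.integrable_minWeight_queue hne hV t
  have h := integral_mono_ae (hi1.fun_add hi2) (hi3.fun_add hi4) ?_
  · rw [integral_add hi1 hi2, integral_add hi3 hi4, integral_const_mul V,
      integral_add (pol.integrable_half_sum_queue_sq t) (integrable_const _)] at h
    simpa only [lyapunov, meanCost, integral_const_mul V, integral_const, probReal_univ,
      one_smul] using h
  · filter_upwards [pol.ae_feasible, hqla t] with ω h hmax
    refine (half_sum_queue_succ_sq_le h t V).trans (add_le_add le_rfl ?_)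
    refine le_minWeight (hne _) fun x hx => ?_
    have := hmax hx
    simp only [Set.mem_ofPred_eq] at this
    have he : ∀ y, N.weight V (pol.queue t ω) (pol.state t ω) y
        = -(-V * N.cost (pol.state t ω) y + ∑ j, pol.queue t ω j *
            (N.service j (pol.state t ω) y - N.traffic j (pol.state t ω) y)) := by
      intro y
      simp only [weight, neg_add, ← Finset.sum_neg_distrib]
      congr 1
      · ring
      · exact Finset.sum_congr rfl fun j _ => by ring
    rw [he, he]
    exact neg_le_neg this

/-- The Poisson equation is applied with the backlogs frozen at time `t`. Updating them in the
potential costs δ · (r δ) = B² per slot of remaining passage time. -/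
theorem integral_minWeight_queue_le (t : ℕ) :
    ∫ ω, N.minWeight V (pol.queue t ω) (pol.state t ω) ∂pol.ℙ
      ≤ pol.weightPotential s₁ V t - pol.weightPotential s₁ V (t + 1) + pol.visitWeight s₁ V t
        + N.B ^ 2 * pol.stateMean (t + 1) (killed s₁ (passageMoment N.P s₁ 1)) := by
  have hnext := pol.integral_next t
    (Y := fun k ω => killed s₁ (N.passageWeight s₁ V (pol.queue t ω)) k)
    (fun k => (continuous_killed_passageWeight H hne hV k).measurable.comp
      (pol.measurable_queue t))
    (pol.integrable_killed_passageWeight H hne hV t (t + 1))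
  have hpt : ∀ ω, ∑' k, (N.P (pol.state t ω) k).toReal
      * killed s₁ (N.passageWeight s₁ V (pol.queue t ω)) k
      = killed s₁ (N.passageWeight s₁ V (pol.queue t ω)) (pol.state t ω)
        + Set.indicator {ω | pol.state t ω = s₁}
          (fun ω => N.passageWeight s₁ V (pol.queue t ω) s₁) ω
        - N.minWeight V (pol.queue t ω) (pol.state t ω) := by
    intro ω
    rw [tsum_mul_killed_passageWeight H hne hV]
    by_cases h : pol.state t ω = s₁
    · have hm : ω ∈ {ω | pol.state t ω = s₁} := h
      rw [Set.indicator_of_mem hm, h, killed_self, zero_add]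
    · have hm : ω ∉ {ω | pol.state t ω = s₁} := h
      rw [Set.indicator_of_notMem hm, killed_of_ne _ h, add_zero]
  simp only [hpt] at hnext
  have hi1 := pol.integrable_killed_passageWeight H hne hV t t
  have hi2 := pol.integrable_indicator_passageWeight H hne hV t
  rw [integral_sub (hi1.fun_add hi2) (pol.integrable_minWeight_queue hne hV t),
    integral_add hi1 hi2] at hnext
  have hstep : pol.weightPotential s₁ V (t + 1)
      ≤ ∫ ω, killed s₁ (N.passageWeight s₁ V (pol.queue t ω)) (pol.state (t + 1) ω) ∂pol.ℙ
        + N.B ^ 2 * pol.stateMean (t + 1) (killed s₁ (passageMoment N.P s₁ 1)) := by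
    have hi3 := pol.integrable_killed_passageWeight H hne hV t (t + 1)
    have hi4 := (pol.integrable_killed (s₁ := s₁) (t + 1)
      (pol.integrable_passageMoment H (Or.inl rfl) (t + 1))).const_mul (N.B ^ 2)
    rw [stateMean, ← integral_const_mul, ← integral_add hi3 hi4]
    refine integral_mono_ae (pol.integrable_killed_passageWeight H hne hV (t + 1) (t + 1))
      (hi3.fun_add hi4) ?_
    filter_upwards [pol.ae_feasible] with ω h
    by_cases hs : pol.state (t + 1) ω = s₁
    · simp [hs]
    · rw [killed_of_ne _ hs, killed_of_ne _ hs, killed_of_ne _ hs]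
      have h1 := (abs_le.1 (abs_passageWeight_sub_le H hne hV (pol.queue (t + 1) ω)
        (pol.queue t ω) (pol.state (t + 1) ω))).2
      have h2 : ∑ j, |pol.queue (t + 1) ω j - pol.queue t ω j| ≤ r * N.deltaMax := by
        have := Finset.sum_le_sum fun j (_ : j ∈ Finset.univ) => abs_queue_succ_sub_le h t j
        simpa using this
      have h3 : N.deltaMax * (∑ j, |pol.queue (t + 1) ω j - pol.queue t ω j|)
          * passageMoment N.P s₁ 1 (pol.state (t + 1) ω)
          ≤ N.B ^ 2 * passageMoment N.P s₁ 1 (pol.state (t + 1) ω) := by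
        refine mul_le_mul_of_nonneg_right ?_ (passageMoment_nonneg 1 _)
        rw [B_sq]
        nlinarith [mul_le_mul_of_nonneg_left h2 N.deltaMax_pos.le]
      linarith
  unfold visitWeight
  unfold weightPotential at hstep ⊢
  linarith

/-- With mean remaining passage time a, the potential can be as low as −δ a (V + ∑ q_j). Completing
squares in the quadratic function absorbs the part with q_j, leaving −B²a²/2, and a² is at most the
second moment. -/
theorem neg_le_lyapunov_add_weightPotential (t : ℕ) :
    -(N.B ^ 2 / 2 * pol.stateMean t (killed s₁ (passageMoment N.P s₁ 2))
      + N.deltaMax * V * pol.stateMean t (killed s₁ (passageMoment N.P s₁ 1)))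
      ≤ pol.lyapunov t + pol.weightPotential s₁ V t := by
  have hi1 := pol.integrable_half_sum_queue_sq t
  have hi2 := pol.integrable_killed_passageWeight H hne hV t t
  have hi3 := (pol.integrable_killed (s₁ := s₁) t
      (pol.integrable_passageMoment H (Or.inr rfl) t)).const_mul (N.B ^ 2 / 2)
  have hi4 := (pol.integrable_killed (s₁ := s₁) t
      (pol.integrable_passageMoment H (Or.inl rfl) t)).const_mul (N.deltaMax * V)
  simp only [stateMean, lyapunov, weightPotential]
  rw [← integral_const_mul, ← integral_const_mul, ← integral_add hi3 hi4, ← integral_add hi1 hi2,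
    ← integral_neg]
  refine integral_mono_ae (hi3.fun_add hi4).fun_neg (hi1.fun_add hi2) ?_
  filter_upwards [pol.ae_feasible] with ω h
  by_cases hs : pol.state t ω = s₁
  · simp only [hs, killed_self, mul_zero, add_zero, neg_zero]
    positivity
  · simp only [killed_of_ne _ hs]
    have h1 := (abs_le.1 (abs_passageWeight_le H hne hV (pol.queue t ω) (pol.state t ω))).1
    have h2 := sq_passageMoment_one_le H (pol.state t ω)
    have habs : ∑ j, |pol.queue t ω j| = ∑ j, pol.queue t ω j :=
      Finset.sum_congr rfl fun j _ => abs_of_nonneg (queue_bounds h t j).1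
    rw [habs] at h1
    set a := passageMoment N.P s₁ 1 (pol.state t ω)
    have h3 : 0 ≤ ∑ j, 1 / 2 * (pol.queue t ω j - N.deltaMax * a) ^ 2 :=
      Finset.sum_nonneg fun j _ => by positivity
    have h4 : ∑ j, 1 / 2 * (pol.queue t ω j - N.deltaMax * a) ^ 2
        = 1 / 2 * ∑ j, pol.queue t ω j ^ 2 - N.deltaMax * a * ∑ j, pol.queue t ω j
          + N.B ^ 2 / 2 * a ^ 2 := by
      have : ∀ j, 1 / 2 * (pol.queue t ω j - N.deltaMax * a) ^ 2
          = 1 / 2 * pol.queue t ω j ^ 2 - N.deltaMax * a * pol.queue t ω j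
            + 1 / 2 * (N.deltaMax * a) ^ 2 := fun j => by ring
      simp only [this, Finset.sum_add_distrib, Finset.sum_sub_distrib, ← Finset.mul_sum,
        Finset.sum_const, Finset.card_univ, Fintype.card_fin, nsmul_eq_mul, B_sq]
      ring
    have h5 : N.B ^ 2 / 2 * a ^ 2 ≤ N.B ^ 2 / 2 * passageMoment N.P s₁ 2 (pol.state t ω) :=
      mul_le_mul_of_nonneg_left h2 (by positivity)
    nlinarith

/-- The sum of the one slot drifts of MaxWeight. -/
theorem sum_meanCost_le (hqla : pol.IsQLA V) (n : ℕ) :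
    V * ∑ t ∈ Finset.range n, pol.meanCost t
      ≤ n * N.B ^ 2 + pol.weightPotential s₁ V 0 + ∑ t ∈ Finset.range n, pol.visitWeight s₁ V t
        + N.B ^ 2 * ∑ t ∈ Finset.range n,
            pol.stateMean (t + 1) (killed s₁ (passageMoment N.P s₁ 1))
        + (N.B ^ 2 / 2 * pol.stateMean n (killed s₁ (passageMoment N.P s₁ 2))
          + N.deltaMax * V * pol.stateMean n (killed s₁ (passageMoment N.P s₁ 1))) := by
  have hsum : pol.lyapunov n + pol.weightPotential s₁ V n
      + V * ∑ t ∈ Finset.range n, pol.meanCost t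
      ≤ n * N.B ^ 2 + pol.weightPotential s₁ V 0 + ∑ t ∈ Finset.range n, pol.visitWeight s₁ V t
        + N.B ^ 2 * ∑ t ∈ Finset.range n,
            pol.stateMean (t + 1) (killed s₁ (passageMoment N.P s₁ 1)) := by
    induction n with
    -- The Lyapunov term is zero at time 0 because the queues start empty.
    | zero => simp [lyapunov, queue]
    | succ n ih =>
      have h1 := pol.lyapunov_succ_le hne hV hqla n
      have h2 := pol.integral_minWeight_queue_le H hne hV n
      simp only [Finset.sum_range_succ, mul_add]
      push_cast
      linarith
  have := pol.neg_le_lyapunov_add_weightPotential H hne hV n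
  linarith

/-- Long run average of the minimal weight for fixed backlogs. -/
theorem tendsto_average_minWeight (q : Fin r → ℝ) :
    Tendsto (fun n : ℕ => (n : ℝ)⁻¹ * ∑ t ∈ Finset.range n, pol.stateMean t (N.minWeight V q))
      atTop (𝓝 (N.passageWeight s₁ V q s₁ / meanReturn N.P s₁)) := by
  set K := N.deltaMax * (V + ∑ j, |q j|)
  have hi : ∀ t, Integrable (fun ω => N.passageWeight s₁ V q (pol.state t ω)) pol.ℙ := fun t =>
    pol.integrable_of_ae_abs_le_mul_passageMoment H t (pol.measurable_state_comp' t _) K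
      (ae_of_all _ fun ω => abs_passageWeight_le H hne hV q _)
  have him : ∀ t, Integrable (fun ω => N.minWeight V q (pol.state t ω)) pol.ℙ := fun t =>
    Integrable.of_bound (pol.measurable_state_comp' t _).aestronglyMeasurable K
      (ae_of_all _ fun ω => abs_minWeight_le hV (hne _) q)
  set a := fun n => pol.stateMean n (killed s₁ (N.passageWeight s₁ V q))
  have hstep : ∀ t, pol.stateMean t (N.minWeight V q)
      = a t - a (t + 1) + N.passageWeight s₁ V q s₁ * pol.visitProb s₁ t := by
    intro t
    have h := pol.integral_next t (Y := fun k _ => killed s₁ (N.passageWeight s₁ V q) k)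
      (fun _ => measurable_const) (pol.integrable_killed (t + 1) (hi (t + 1)))
    simp only [tsum_mul_killed_passageWeight H hne hV] at h
    rw [integral_sub (hi t) (him t)] at h
    have h2 := pol.stateMean_eq_killed_add (s₁ := s₁) t (hi t)
    simp only [a]
    unfold stateMean at h2 ⊢
    linarith
  have hsum : ∀ n : ℕ, ∑ t ∈ Finset.range n, pol.stateMean t (N.minWeight V q)
      = a 0 - a n + N.passageWeight s₁ V q s₁ * ∑ t ∈ Finset.range n, pol.visitProb s₁ t := by
    intro n
    induction n with
    | zero => simp
    | succ n ih => rw [Finset.sum_range_succ, ih, hstep, Finset.sum_range_succ]; ring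
  have ha : Tendsto (fun n : ℕ => (n : ℝ)⁻¹ * a n) atTop (𝓝 0) := by
    have h1 := (pol.tendsto_stateMean_passage_one H).const_mul K
    rw [mul_zero] at h1
    refine squeeze_zero_norm (fun n => ?_) h1
    rw [norm_mul, norm_inv, Real.norm_natCast, mul_left_comm]
    refine mul_le_mul_of_nonneg_left ?_ (by positivity)
    rw [stateMean, ← integral_const_mul]
    refine norm_integral_le_of_norm_le ((pol.integrable_killed n
      (pol.integrable_passageMoment H (Or.inl rfl) n)).const_mul K) (ae_of_all _ fun ω => ?_)
    by_cases hs : pol.state n ω = s₁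
    · simp [hs]
    · rw [killed_of_ne _ hs, killed_of_ne _ hs]
      exact abs_passageWeight_le H hne hV q _
  have h0 := tendsto_inv_atTop_nhds_zero_nat (𝕜 := ℝ)
  have hlim := ((h0.mul_const (a 0)).sub ha).add
    ((pol.tendsto_visitProb H).const_mul (N.passageWeight s₁ V q s₁))
  simp only [zero_mul, sub_zero, zero_add, ← div_eq_mul_inv] at hlim
  refine hlim.congr fun n => ?_
  rw [hsum]
  ring

-- Applies to any policy: its action has weight at least the minimum, and for multipliers `q ≥ 0`
-- the traffic minus service terms are bounded by telescoping backlog increments.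
omit H in
theorem sum_stateMean_minWeight_le {q : Fin r → ℝ} (hq : ∀ j, 0 ≤ q j) (n : ℕ) :
    ∑ t ∈ Finset.range n, pol.stateMean t (N.minWeight V q)
      ≤ V * ∑ t ∈ Finset.range n, pol.meanCost t + ∑ j, q j * ∫ ω, pol.queue n ω j ∂pol.ℙ := by
  have him : ∀ t, Integrable (fun ω => N.minWeight V q (pol.state t ω)) pol.ℙ := fun t =>
    Integrable.of_bound (pol.measurable_state_comp' t _).aestronglyMeasurable _
      (ae_of_all _ fun ω => abs_minWeight_le hV (hne _) q)
  have hiq : ∀ t, Integrable (fun ω => ∑ j, q j * pol.queue t ω j) pol.ℙ := fun t =>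
    integrable_finsetSum _ fun j _ => (pol.integrable_queue t j).const_mul _
  have hval : ∀ t, ∫ ω, ∑ j, q j * pol.queue t ω j ∂pol.ℙ
      = ∑ j, q j * ∫ ω, pol.queue t ω j ∂pol.ℙ := fun t => by
    rw [integral_finsetSum _ fun j _ => (pol.integrable_queue t j).const_mul _]
    exact Finset.sum_congr rfl fun j _ => integral_const_mul _ _
  rw [← hval]
  induction n with
  | zero => simp [queue]
  | succ n ih =>
    have hi1 := (him n).fun_add (hiq n)
    have hi2 := ((pol.integrable_cost n).const_mul V).fun_add (hiq (n + 1))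
    have h := integral_mono_ae hi1 hi2 ?_
    · rw [integral_add (him n) (hiq n), integral_add ((pol.integrable_cost n).const_mul V)
        (hiq (n + 1)), integral_const_mul] at h
      rw [Finset.sum_range_succ, Finset.sum_range_succ, mul_add]
      unfold meanCost at ih ⊢
      unfold stateMean at ih ⊢
      linarith
    · filter_upwards [pol.ae_feasible] with ω hω
      have h1 := minWeight_le hV (hω n) q
      have h2 := Finset.sum_le_sum fun j (_ : j ∈ Finset.univ) =>
        mul_le_mul_of_nonneg_left (queue_sub_le_queue_succ n ω j) (hq j)
      simp only [mul_add, Finset.sum_add_distrib] at h2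
      unfold weight at h1
      linarith

end

end StochasticNetwork.Policy

/-! ### Limsups of time averages -/

theorem limsupTimeAverage_le {a u : ℕ → ℝ} {c : ℝ} (hu : Tendsto u atTop (𝓝 c))
    (h : ∀ᶠ n : ℕ in atTop, (n : ℝ)⁻¹ * ∑ t ∈ Finset.range n, a t ≤ u n) :
    limsupTimeAverage a ≤ (c : EReal) := by
  have h1 : limsup (fun n => (u n : EReal)) atTop = c :=
    ((continuous_coe_real_ereal.tendsto c).comp hu).limsup_eq
  rw [← h1]
  refine limsup_le_limsup ?_
  filter_upwards [h] with n hn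
  rw [one_div]
  exact_mod_cast hn

/-- A lower bound at infinitely many times suffices for a limsup; stability makes E[q(n)]/n small
only along a subsequence. -/
theorem le_limsupTimeAverage {a : ℕ → ℝ} {c : ℝ}
    (h : ∀ c' < c, ∃ᶠ n : ℕ in atTop, c' ≤ (n : ℝ)⁻¹ * ∑ t ∈ Finset.range n, a t) :
    (c : EReal) ≤ limsupTimeAverage a := by
  refine EReal.ge_of_forall_gt_iff_ge.1 fun z hz => ?_
  refine le_limsup_of_frequently_le ((h z (by exact_mod_cast hz)).mono fun n hn => ?_)
  rw [one_div]
  exact_mod_cast hn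

theorem eventually_average_le_of_limsupTimeAverage_lt_top {a : ℕ → ℝ}
    (h : limsupTimeAverage a < ⊤) :
    ∃ M : ℝ, ∀ᶠ n : ℕ in atTop, (n : ℝ)⁻¹ * ∑ t ∈ Finset.range n, a t ≤ M := by
  obtain ⟨M, hM, -⟩ := EReal.lt_iff_exists_real_btwn.1 h
  refine ⟨M, (eventually_lt_of_limsup_lt hM).mono fun n hn => ?_⟩
  rw [one_div] at hn
  exact_mod_cast hn.le

/-- A nonnegative sequence with bounded time averages is infinitely often small compared with the
index. -/
theorem frequently_inv_mul_lt_of_average_le {a : ℕ → ℝ} (ha : ∀ n, 0 ≤ a n) {M : ℝ}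
    (h : ∀ᶠ n : ℕ in atTop, (n : ℝ)⁻¹ * ∑ t ∈ Finset.range n, a t ≤ M) {ε : ℝ} (hε : 0 < ε) :
    ∃ᶠ n : ℕ in atTop, (n : ℝ)⁻¹ * a n < ε := by
  rw [frequently_iff_forall_eventually_exists_and]
  intro p hp
  by_contra hcon
  push Not at hcon
  obtain ⟨n₀, hn₀⟩ := eventually_atTop.1 (hp.and h)
  -- If a(t) ≥ ε t for all large t, the block [n, 2n) alone contributes ε n², against an allowance
  -- of 2nM for the sum up to 2n; any n > 2M/ε is contradictory.
  obtain ⟨m, hm⟩ := exists_nat_gt (2 * M / ε)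
  set n := max (max n₀ m) 1 with hn
  have hn1 : 1 ≤ n := le_max_right _ _
  have hnn : n₀ ≤ n := (le_max_left _ _).trans (le_max_left _ _)
  have hmn : (m : ℝ) ≤ n := by exact_mod_cast (le_max_right n₀ m).trans (le_max_left _ _)
  have hnpos : (0 : ℝ) < n := by exact_mod_cast hn1
  have hlow : ∀ t ∈ Finset.Ico n (2 * n), ε * n ≤ a t := by
    intro t ht
    have htn : n ≤ t := (Finset.mem_Ico.1 ht).1
    have h1 : ε ≤ (t : ℝ)⁻¹ * a t := not_lt.1 fun hl => hcon t hl (hn₀ t (hnn.trans htn)).1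
    have htpos : (0 : ℝ) < t := by exact_mod_cast hn1.trans htn
    have htn' : (n : ℝ) ≤ t := by exact_mod_cast htn
    rw [inv_mul_eq_div, le_div_iff₀ htpos] at h1
    exact (mul_le_mul_of_nonneg_left htn' hε.le).trans h1
  have hs1 := Finset.card_nsmul_le_sum _ _ _ hlow
  rw [Nat.card_Ico, show 2 * n - n = n by omega, nsmul_eq_mul] at hs1
  have hs2 : ∑ t ∈ Finset.Ico n (2 * n), a t ≤ ∑ t ∈ Finset.range (2 * n), a t :=
    Finset.sum_le_sum_of_subset_of_nonneg (fun t ht => by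
      simp only [Finset.mem_range]; exact (Finset.mem_Ico.1 ht).2) fun t _ _ => ha t
  have h2 := (hn₀ (2 * n) (by omega)).2
  have h2pos : (0 : ℝ) < ((2 * n : ℕ) : ℝ) := by push_cast; linarith
  rw [inv_mul_eq_div, div_le_iff₀ h2pos] at h2
  push_cast at h2
  rw [div_lt_iff₀ hε] at hm
  nlinarith [mul_le_mul_of_nonneg_right hmn hε.le]

/-! ### Slackness, weak duality, and the two MaxWeight bounds -/

namespace StochasticNetwork

open MarkovChain

section Slackness

variable {S : Type v} {X : Type w} [TopologicalSpace X] [MeasurableSpace X] {r : ℕ}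
  {N : StochasticNetwork S X r} {s₁ : S}

theorem abs_convexComb_le {ι : Type*} [Fintype ι] {θ y : ι → ℝ} {c : ℝ} (h0 : ∀ k, 0 ≤ θ k)
    (h1 : ∑ k, θ k = 1) (h : ∀ k, |y k| ≤ c) : |∑ k, θ k * y k| ≤ c := by
  refine (Finset.abs_sum_le_sum_abs _ _).trans ?_
  calc ∑ k, |θ k * y k| ≤ ∑ k, θ k * c := Finset.sum_le_sum fun k _ => by
        rw [abs_mul, abs_of_nonneg (h0 k)]
        exact mul_le_mul_of_nonneg_left (h k) (h0 k)
    _ = c := by rw [← Finset.sum_mul, h1, one_mul]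

theorem Slackness.feasible_nonempty {η : ℝ} (hη : N.Slackness η) (s : S) :
    (N.feasible s).Nonempty := by
  obtain ⟨-, x, θ, hx, -⟩ := hη
  exact ⟨x s 0, hx s 0⟩

/-- A queue cannot drain faster than δ per slot. At least one queue is needed for the condition to
say anything. -/
theorem Slackness.le_deltaMax {η : ℝ} (hη : N.Slackness η) (hr : 1 ≤ r) : η ≤ N.deltaMax := by
  obtain ⟨-, x, θ, hx, hθ0, hθ1, hs⟩ := hη
  have h := hs ⟨0, hr⟩
  have hb : ∀ s, ‖(N.steady s).toReal * ∑ k, θ s k * (N.traffic ⟨0, hr⟩ s (x s k)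
      - N.service ⟨0, hr⟩ s (x s k))‖ ≤ (N.steady s).toReal * N.deltaMax := by
    intro s
    rw [norm_mul, Real.norm_of_nonneg ENNReal.toReal_nonneg]
    exact mul_le_mul_of_nonneg_left (abs_convexComb_le (hθ0 s) (hθ1 s)
      fun k => abs_traffic_sub_service_le (hx s k) _) ENNReal.toReal_nonneg
  have hsum : HasSum (fun s => (N.steady s).toReal * N.deltaMax) (1 * N.deltaMax) := by
    refine HasSum.mul_right _ ?_
    have := ENNReal.hasSum_toReal (f := fun s => N.steady s) N.steady.tsum_coe_ne_top
    rwa [← ENNReal.tsum_toReal_eq fun s => PMF.apply_ne_top _ _, PMF.tsum_coe,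
      ENNReal.toReal_one] at this
  have hle := tsum_of_norm_bounded hsum hb
  rw [Real.norm_eq_abs, abs_le] at hle
  linarith

/-- Under slackness the weight of a cycle has a negative drift in the backlogs. -/
theorem Slackness.exists_passageWeight_le {η : ℝ} (hη : N.Slackness η)
    (H : ∀ i, hittingMoment N.P 2 i s₁ < ⊤) :
    ∃ c : ℝ, (∀ V : ℝ, 0 ≤ V → ∀ q : Fin r → ℝ, (∀ j, 0 ≤ q j) →
        N.passageWeight s₁ V q s₁ ≤ V * c - η * meanReturn N.P s₁ * ∑ j, q j) ∧
      (((∀ s, ∀ x ∈ N.feasible s, 0 ≤ N.cost s x) ∧ c ≤ N.deltaMax * meanReturn N.P s₁) ∨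
        ((∀ s, ∀ x ∈ N.feasible s, N.cost s x ≤ 0) ∧ c ≤ 0)) := by
  have hne := hη.feasible_nonempty
  obtain ⟨-, x, θ, hx, hθ0, hθ1, hs⟩ := hη
  set f : S → ℝ := fun s => ∑ k, θ s k * N.cost s (x s k)
  set d : Fin r → S → ℝ := fun j s => ∑ k, θ s k * (N.traffic j s (x s k) - N.service j s (x s k))
  have hf : ∀ s, |f s| ≤ N.deltaMax := fun s =>
    abs_convexComb_le (hθ0 s) (hθ1 s) fun k => N.abs_cost_le s _ (hx s k)
  have hd : ∀ j s, |d j s| ≤ N.deltaMax := fun j s =>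
    abs_convexComb_le (hθ0 s) (hθ1 s) fun k => abs_traffic_sub_service_le (hx s k) _
  -- The constant is the expected cost over one cycle of the randomized choice from the slackness
  -- condition.
  refine ⟨cycleSum N.P s₁ f s₁, fun V hV q hq => ?_, ?_⟩
  · have hVf : ∀ s, |V * f s| ≤ V * N.deltaMax := fun s => by
      rw [abs_mul, abs_of_nonneg hV]; exact mul_le_mul_of_nonneg_left (hf s) hV
    have hqd : ∀ j s, |q j * d j s| ≤ q j * N.deltaMax := fun j s => by
      rw [abs_mul, abs_of_nonneg (hq j)]; exact mul_le_mul_of_nonneg_left (hd j s) (hq j)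
    have hqds : ∀ s, |∑ j, q j * d j s| ≤ ∑ j, q j * N.deltaMax := fun s =>
      (Finset.abs_sum_le_sum_abs _ _).trans (Finset.sum_le_sum fun j _ => hqd j s)
    have hle : ∀ s, N.minWeight V q s ≤ V * f s + ∑ j, q j * d j s := by
      intro s
      calc N.minWeight V q s = ∑ k, θ s k * N.minWeight V q s := by
            rw [← Finset.sum_mul, hθ1, one_mul]
        _ ≤ ∑ k, θ s k * N.weight V q s (x s k) := Finset.sum_le_sum fun k _ =>
            mul_le_mul_of_nonneg_left (minWeight_le hV (hx s k) q) (hθ0 s k)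
        _ = V * f s + ∑ j, q j * d j s := by
            simp only [weight, f, d, mul_add, Finset.sum_add_distrib, Finset.mul_sum]
            congr 1
            · exact Finset.sum_congr rfl fun k _ => by ring
            · rw [Finset.sum_comm]
              exact Finset.sum_congr rfl fun j _ => Finset.sum_congr rfl fun k _ => by ring
    have h1 := cycleSum_mono H (fun s => abs_minWeight_le hV (hne s) q)
      (fun s => (abs_add_le _ _).trans (add_le_add (hVf s) (hqds s))) hle s₁
    rw [cycleSum_add H hVf hqds, cycleSum_const_mul, cycleSum_sum H _ hqd] at h1
    have h2 : ∑ j, cycleSum N.P s₁ (fun k => q j * d j k) s₁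
        ≤ ∑ j, q j * (meanReturn N.P s₁ * -η) := by
      refine Finset.sum_le_sum fun j _ => ?_
      rw [cycleSum_const_mul, cycleSum_eq_mul_stationary H N.stationary,
        meanReturn_eq_passageMoment H]
      exact mul_le_mul_of_nonneg_left (mul_le_mul_of_nonneg_left (hs j)
        (passageMoment_nonneg _ _)) (hq j)
    rw [← Finset.sum_mul] at h2
    unfold passageWeight
    linarith
  · rcases N.cost_sign with h | h
    · refine Or.inl ⟨h, ?_⟩
      rw [meanReturn_eq_passageMoment H]
      exact (le_abs_self _).trans (abs_cycleSum_le H hf s₁)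
    · refine Or.inr ⟨h, ?_⟩
      refine tsum_nonpos fun k => mul_nonpos_of_nonneg_of_nonpos ENNReal.toReal_nonneg ?_
      exact Finset.sum_nonpos fun l _ => mul_nonpos_of_nonneg_of_nonpos (hθ0 k l) (h k _ (hx k l))

end Slackness

namespace Policy

variable {S : Type v} [Countable S] {X : Type w} [TopologicalSpace X] [MeasurableSpace X] {r : ℕ}
  {N : StochasticNetwork S X r} {s₀ s₁ : S} (pol : Policy.{u} N s₀)

omit [Countable S] in
theorem avgCost_eq : pol.avgCost = limsupTimeAverage pol.meanCost := rfl

theorem avgBacklog_eq : pol.avgBacklog = limsupTimeAverage pol.meanBacklog := by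
  unfold avgBacklog
  congr 1
  funext t
  exact (pol.meanBacklog_eq t).symm

omit [Countable S] in
theorem meanBacklog_nonneg (t : ℕ) : 0 ≤ pol.meanBacklog t := by
  refine integral_nonneg_of_ae ?_
  filter_upwards [pol.ae_feasible] with ω h
  exact (totalBacklog_bounds h t).1

section

variable (H : ∀ i, hittingMoment N.P 2 i s₁ < ⊤) (hne : ∀ s, (N.feasible s).Nonempty)
  {V : ℝ}
include H hne

/-- Weak duality: the dual function bounds the cost of every stable policy from below. -/
theorem passageWeight_le_avgCost (hV : 0 < V) (hst : pol.Stable) {q : Fin r → ℝ}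
    (hq : ∀ j, 0 ≤ q j) :
    ((N.passageWeight s₁ V q s₁ / (meanReturn N.P s₁ * V) : ℝ) : EReal) ≤ pol.avgCost := by
  have hT := meanReturn_pos H
  rw [avgCost_eq]
  refine le_limsupTimeAverage fun c' hc' => ?_
  set γ := N.passageWeight s₁ V q s₁
  set T := meanReturn N.P s₁
  have hlt : V * c' < γ / T := by
    rw [lt_div_iff₀ (by positivity)] at hc'
    rw [lt_div_iff₀ hT]
    linarith
  obtain ⟨M, hM⟩ := eventually_average_le_of_limsupTimeAverage_lt_top
    (by rw [← pol.avgBacklog_eq]; exact hst)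
  set m := (V * c' + γ / T) / 2
  have hm1 : V * c' < m := by simp only [m]; linarith
  have hm2 : m < γ / T := by simp only [m]; linarith
  have hsq : 0 ≤ ∑ j, q j := Finset.sum_nonneg fun j _ => hq j
  -- `m` halves the gap: one half covers the convergence of the average minimal weight, the other
  -- the backlog term. The `+ 1` allows `q = 0`.
  set ε := (m - V * c') / (∑ j, q j + 1)
  have hε : 0 < ε := div_pos (by linarith) (by linarith)
  have hεm : (∑ j, q j) * ε ≤ m - V * c' := by
    have : ε * (∑ j, q j + 1) = m - V * c' := div_mul_cancel₀ _ (by positivity)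
    linarith
  refine ((frequently_inv_mul_lt_of_average_le pol.meanBacklog_nonneg hM hε).and_eventually
    ((pol.tendsto_average_minWeight H hne hV.le q).eventually_const_lt hm2)).mono ?_
  rintro n ⟨h1, h2⟩
  have h3 := mul_le_mul_of_nonneg_left (pol.sum_stateMean_minWeight_le hne hV.le hq n)
    (inv_nonneg.2 (Nat.cast_nonneg (α := ℝ) n))
  have h4 : ∑ j, q j * ∫ ω, pol.queue n ω j ∂pol.ℙ ≤ (∑ j, q j) * pol.meanBacklog n := by
    rw [meanBacklog_eq, Finset.sum_mul]
    refine Finset.sum_le_sum fun j _ => mul_le_mul_of_nonneg_left ?_ (hq j)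
    refine Finset.single_le_sum (f := fun j => ∫ ω, pol.queue n ω j ∂pol.ℙ) (fun i _ => ?_)
      (Finset.mem_univ j)
    refine integral_nonneg_of_ae ?_
    filter_upwards [pol.ae_feasible] with ω h
    exact (queue_bounds h n i).1
  have h5 := mul_le_mul_of_nonneg_left h4 (inv_nonneg.2 (Nat.cast_nonneg (α := ℝ) n))
  have h6 := mul_le_mul_of_nonneg_left h1.le hsq
  have h7 : V * c' ≤ V * ((n : ℝ)⁻¹ * ∑ t ∈ Finset.range n, pol.meanCost t) := by
    rw [mul_add] at h3
    linarith
  exact le_of_mul_le_mul_left h7 hV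

omit hne in
/-- Limit of the error terms in the summed drift inequality. -/
theorem tendsto_drift_error :
    Tendsto (fun n : ℕ => N.B ^ 2 + (n : ℝ)⁻¹ * pol.weightPotential s₁ V 0
      + N.B ^ 2 * ((n : ℝ)⁻¹ * ∑ t ∈ Finset.range n,
            pol.stateMean (t + 1) (killed s₁ (passageMoment N.P s₁ 1)))
      + (N.B ^ 2 / 2 * ((n : ℝ)⁻¹ * pol.stateMean n (killed s₁ (passageMoment N.P s₁ 2)))
        + N.deltaMax * V * ((n : ℝ)⁻¹ * pol.stateMean n (killed s₁ (passageMoment N.P s₁ 1)))))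
      atTop (𝓝 (N.B ^ 2 * N.constC s₁ / (2 * meanReturn N.P s₁))) := by
  have hT := meanReturn_pos H
  have h0 := tendsto_inv_atTop_nhds_zero_nat (𝕜 := ℝ)
  have h := ((tendsto_const_nhds (x := N.B ^ 2)).add
    (h0.mul_const (pol.weightPotential s₁ V 0))).add
    ((pol.tendsto_average_passage H).const_mul (N.B ^ 2)) |>.add
    (((pol.tendsto_stateMean_passage_two H).const_mul (N.B ^ 2 / 2)).add
      ((pol.tendsto_stateMean_passage_one H).const_mul (N.deltaMax * V)))
  convert h using 2
  rw [constC, constD]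
  field_simp
  ring

theorem average_meanCost_le (hV : 0 ≤ V) (hqla : pol.IsQLA V) {n : ℕ} (hn : 0 < n) :
    V * ((n : ℝ)⁻¹ * ∑ t ∈ Finset.range n, pol.meanCost t)
      ≤ (N.B ^ 2 + (n : ℝ)⁻¹ * pol.weightPotential s₁ V 0
      + N.B ^ 2 * ((n : ℝ)⁻¹ * ∑ t ∈ Finset.range n,
            pol.stateMean (t + 1) (killed s₁ (passageMoment N.P s₁ 1)))
      + (N.B ^ 2 / 2 * ((n : ℝ)⁻¹ * pol.stateMean n (killed s₁ (passageMoment N.P s₁ 2)))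
        + N.deltaMax * V * ((n : ℝ)⁻¹ * pol.stateMean n (killed s₁ (passageMoment N.P s₁ 1)))))
        + (n : ℝ)⁻¹ * ∑ t ∈ Finset.range n, pol.visitWeight s₁ V t := by
  have h := mul_le_mul_of_nonneg_left (pol.sum_meanCost_le H hne hV hqla n)
    (inv_nonneg.2 (Nat.cast_nonneg (α := ℝ) n))
  have hn' : (n : ℝ)⁻¹ * n = 1 := inv_mul_cancel₀ (by positivity)
  have h2 : (n : ℝ)⁻¹ * (n * N.B ^ 2) = N.B ^ 2 := by rw [← mul_assoc, hn', one_mul]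
  simp only [mul_add, h2] at h
  linarith

/-- Used twice: with `b = 0` and the dual bound for the cost, and with `b` equal to η times the mean
return time for the backlog. -/
theorem visitWeight_le (hV : 0 ≤ V) {a b : ℝ}
    (h : ∀ q : Fin r → ℝ, (∀ j, 0 ≤ q j) → N.passageWeight s₁ V q s₁ ≤ a - b * ∑ j, q j) (t : ℕ) :
    pol.visitWeight s₁ V t ≤ a * pol.visitProb s₁ t - b * pol.visitBacklog s₁ t := by
  have hi1 : Integrable (Set.indicator {ω | pol.state t ω = s₁} fun _ => a) pol.ℙ :=
    (integrable_const a).indicator (pol.measurableSet_state t s₁)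
  have hi2 : Integrable (fun ω => b * Set.indicator {ω | pol.state t ω = s₁}
      (fun ω => ∑ j, pol.queue t ω j) ω) pol.ℙ :=
    ((pol.integrable_totalBacklog t).indicator (pol.measurableSet_state t s₁)).const_mul _
  have he : a * pol.visitProb s₁ t - b * pol.visitBacklog s₁ t
      = ∫ ω, (Set.indicator {ω | pol.state t ω = s₁} (fun _ => a) ω
        - b * Set.indicator {ω | pol.state t ω = s₁} (fun ω => ∑ j, pol.queue t ω j) ω) ∂pol.ℙ := by
    rw [integral_sub hi1 hi2, integral_const_mul,
      integral_indicator_const _ (pol.measurableSet_state t s₁), smul_eq_mul, mul_comm a]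
    rfl
  rw [he]
  refine integral_mono_ae (pol.integrable_indicator_passageWeight H hne hV t) (hi1.sub hi2) ?_
  filter_upwards [pol.ae_feasible] with ω hω
  by_cases hs : ω ∈ {ω | pol.state t ω = s₁}
  · simp only [Set.indicator_of_mem hs]
    exact h _ fun j => (queue_bounds hω t j).1
  · simp only [Set.indicator_of_notMem hs, mul_zero, sub_zero, le_refl]

/-- MaxWeight is nearly optimal with respect to the dual problem. -/
theorem IsQLA.avgCost_le (hV : 0 < V) (hqla : pol.IsQLA V) {x : ℝ}
    (hx : ∀ q : Fin r → ℝ, (∀ j, 0 ≤ q j) →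
      N.passageWeight s₁ V q s₁ ≤ meanReturn N.P s₁ * V * x) :
    pol.avgCost ≤ ((x + N.constC s₁ * N.B ^ 2 / (2 * (V * meanReturn N.P s₁)) : ℝ) : EReal) := by
  have hT := meanReturn_pos H
  rw [avgCost_eq]
  have hlim := ((pol.tendsto_drift_error H (V := V)).add
    ((pol.tendsto_visitProb H).const_mul (meanReturn N.P s₁ * V * x))).const_mul V⁻¹
  have hval : V⁻¹ * (N.B ^ 2 * N.constC s₁ / (2 * meanReturn N.P s₁)
      + meanReturn N.P s₁ * V * x * (meanReturn N.P s₁)⁻¹)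
      = x + N.constC s₁ * N.B ^ 2 / (2 * (V * meanReturn N.P s₁)) := by
    field_simp; ring
  rw [hval] at hlim
  refine limsupTimeAverage_le hlim ?_
  filter_upwards [eventually_gt_atTop 0] with n hn
  have h1 := pol.average_meanCost_le H hne hV.le hqla hn
  have h2 : ∑ t ∈ Finset.range n, pol.visitWeight s₁ V t
      ≤ meanReturn N.P s₁ * V * x * ∑ t ∈ Finset.range n, pol.visitProb s₁ t := by
    rw [Finset.mul_sum]
    refine Finset.sum_le_sum fun t _ => ?_
    have := pol.visitWeight_le H hne hV.le (a := meanReturn N.P s₁ * V * x) (b := 0)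
      (fun q hq => by simpa using hx q hq) t
    simpa using this
  have h3 := mul_le_mul_of_nonneg_left h2 (inv_nonneg.2 (Nat.cast_nonneg (α := ℝ) n))
  rw [le_inv_mul_iff₀ hV]
  linarith

/-- Weak duality for a stable policy is precisely the hypothesis of `IsQLA.avgCost_le` with `x` that
policy's cost, so MaxWeight is compared with each stable policy separately and the infimum taken
afterwards. -/
theorem IsQLA.avgCost_le_optCost (hV : 0 < V) (hqla : pol.IsQLA V) :
    pol.avgCost ≤ optCost.{u} N s₀
      + ((N.constC s₁ * N.B ^ 2 / (2 * (V * meanReturn N.P s₁)) : ℝ) : EReal) := by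
  have hT := meanReturn_pos H
  rw [← EReal.sub_le_iff_le_add (Or.inl (EReal.coe_ne_bot _)) (Or.inl (EReal.coe_ne_top _))]
  refine le_iInf₂ fun pol' hst => ?_
  rw [EReal.sub_le_iff_le_add (Or.inl (EReal.coe_ne_bot _)) (Or.inl (EReal.coe_ne_top _))]
  have hdual := fun (q : Fin r → ℝ) (hq : ∀ j, 0 ≤ q j) =>
    pol'.passageWeight_le_avgCost H hne hV hst hq
  generalize pol'.avgCost = y at hdual
  induction y with
  -- The dual value at `q = 0` is a real number, so the cost is not −∞.
  | bot => exact absurd (hdual 0 fun _ => le_rfl) (by simp)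
  | top => rw [EReal.top_add_coe]; exact le_top
  | coe x =>
    rw [← EReal.coe_add]
    refine IsQLA.avgCost_le pol H hne hV hqla fun q hq => ?_
    have := EReal.coe_le_coe_iff.1 (hdual q hq)
    rw [div_le_iff₀ (by positivity)] at this
    linarith

omit hne in
theorem IsQLA.avgBacklog_le {η : ℝ} (hη : N.Slackness η) (hV : 0 ≤ V) (hqla : pol.IsQLA V) :
    pol.avgBacklog ≤ ((η⁻¹ * (N.B ^ 2 * N.constC s₁ / (2 * meanReturn N.P s₁) + V * N.deltaMax)
      + r * N.deltaMax * (N.constD s₁ / (2 * meanReturn N.P s₁)) : ℝ) : EReal) := by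
  have hT := meanReturn_pos H
  have hne := hη.feasible_nonempty
  have hη0 := hη.1
  obtain ⟨c, hc, hsign⟩ := hη.exists_passageWeight_le H
  rw [avgBacklog_eq]
  set T := meanReturn N.P s₁
  -- One majorant tending to 1 serves both signs of the cost: the visit frequency times T for
  -- nonnegative costs, the constant 1 for nonpositive ones.
  have hmax : Tendsto (fun n : ℕ => max (T * ((n : ℝ)⁻¹ * ∑ t ∈ Finset.range n,
      pol.visitProb s₁ t)) 1) atTop (𝓝 1) := by
    have := ((pol.tendsto_visitProb H).const_mul T).max (tendsto_const_nhds (x := (1 : ℝ)))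
    rwa [mul_inv_cancel₀ hT.ne', max_self] at this
  have hlim := (((pol.tendsto_drift_error H (V := V)).add
    (hmax.const_mul (V * N.deltaMax))).const_mul η⁻¹).add
    ((pol.tendsto_average_passage H).const_mul (r * N.deltaMax))
  rw [mul_one] at hlim
  refine limsupTimeAverage_le hlim ?_
  filter_upwards [eventually_gt_atTop 0] with n hn
  have hn0 : (0 : ℝ) < n := by exact_mod_cast hn
  have hninv : 0 ≤ (n : ℝ)⁻¹ := by positivity
  have h1 := pol.average_meanCost_le H hne hV hqla hn
  have h2 : ∑ t ∈ Finset.range n, pol.visitWeight s₁ V t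
      ≤ V * c * ∑ t ∈ Finset.range n, pol.visitProb s₁ t
        - η * T * ∑ t ∈ Finset.range n, pol.visitBacklog s₁ t := by
    rw [Finset.mul_sum, Finset.mul_sum, ← Finset.sum_sub_distrib]
    exact Finset.sum_le_sum fun t _ => pol.visitWeight_le H hne hV (hc V hV) t
  have h3 : ∑ t ∈ Finset.range n, pol.meanBacklog t
      ≤ T * ∑ t ∈ Finset.range n, pol.visitBacklog s₁ t
        + r * N.deltaMax * ∑ t ∈ Finset.range n,
          pol.stateMean (t + 1) (killed s₁ (passageMoment N.P s₁ 1)) := by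
    -- The final potential is kept on the left so that the induction telescopes, and discarded
    -- afterwards by positivity.
    have hind : ∑ t ∈ Finset.range n, pol.meanBacklog t + pol.backlogPotential s₁ n
        ≤ T * ∑ t ∈ Finset.range n, pol.visitBacklog s₁ t
        + r * N.deltaMax * ∑ t ∈ Finset.range n,
          pol.stateMean (t + 1) (killed s₁ (passageMoment N.P s₁ 1)) := by
      clear h1 h2 hninv hn0 hn
      induction n with
      | zero => simp [backlogPotential, queue]
      | succ n ih =>
        have := pol.meanBacklog_le H n
        simp only [Finset.sum_range_succ, mul_add]
        linarith
    linarith [pol.backlogPotential_nonneg (s₁ := s₁) n]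
  -- The constant sign of the cost pays off here: one of the two terms has a favourable sign and is
  -- dropped, so the gap is asymptotically δ rather than 2δ.
  have h4 : (n : ℝ)⁻¹ * (c * ∑ t ∈ Finset.range n, pol.visitProb s₁ t
      - ∑ t ∈ Finset.range n, pol.meanCost t)
      ≤ N.deltaMax * max (T * ((n : ℝ)⁻¹ * ∑ t ∈ Finset.range n, pol.visitProb s₁ t)) 1 := by
    have hp : 0 ≤ ∑ t ∈ Finset.range n, pol.visitProb s₁ t :=
      Finset.sum_nonneg fun t _ => measureReal_nonneg
    rcases hsign with ⟨hf, hcle⟩ | ⟨hf, hcle⟩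
    · have hF : 0 ≤ ∑ t ∈ Finset.range n, pol.meanCost t := Finset.sum_nonneg fun t _ => by
        refine integral_nonneg_of_ae ?_
        filter_upwards [pol.ae_feasible] with ω h
        exact hf _ _ (h t)
      have h5 : c * ∑ t ∈ Finset.range n, pol.visitProb s₁ t
          - ∑ t ∈ Finset.range n, pol.meanCost t
          ≤ N.deltaMax * T * ∑ t ∈ Finset.range n, pol.visitProb s₁ t := by
        linarith [mul_le_mul_of_nonneg_right hcle hp]
      calc _ ≤ (n : ℝ)⁻¹ * (N.deltaMax * T * ∑ t ∈ Finset.range n, pol.visitProb s₁ t) :=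
            mul_le_mul_of_nonneg_left h5 hninv
        _ = N.deltaMax * (T * ((n : ℝ)⁻¹ * ∑ t ∈ Finset.range n, pol.visitProb s₁ t)) := by ring
        _ ≤ _ := mul_le_mul_of_nonneg_left (le_max_left _ _) N.deltaMax_pos.le
    · have hF : -(n * N.deltaMax) ≤ ∑ t ∈ Finset.range n, pol.meanCost t := by
        have hb : ∀ t ∈ Finset.range n, -N.deltaMax ≤ pol.meanCost t := by
          intro t _
          have h := integral_mono_ae (integrable_const (-N.deltaMax)) (pol.integrable_cost t) (by
            filter_upwards [pol.ae_feasible] with ω h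
            exact (abs_le.1 (N.abs_cost_le _ _ (h t))).1)
          simpa [meanCost] using h
        have := Finset.card_nsmul_le_sum _ _ _ hb
        simpa using this
      have h5 : c * ∑ t ∈ Finset.range n, pol.visitProb s₁ t
          - ∑ t ∈ Finset.range n, pol.meanCost t ≤ n * N.deltaMax := by
        linarith [mul_nonpos_of_nonpos_of_nonneg hcle hp]
      calc _ ≤ (n : ℝ)⁻¹ * (n * N.deltaMax) := mul_le_mul_of_nonneg_left h5 hninv
        _ = N.deltaMax * 1 := by field_simp
        _ ≤ _ := mul_le_mul_of_nonneg_left (le_max_right _ _) N.deltaMax_pos.le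
  have h2' := mul_le_mul_of_nonneg_left h2 hninv
  have h3' := mul_le_mul_of_nonneg_left h3 hninv
  have h4' := mul_le_mul_of_nonneg_left h4 hV
  have h6 : T * ((n : ℝ)⁻¹ * ∑ t ∈ Finset.range n, pol.visitBacklog s₁ t)
      ≤ η⁻¹ * ((N.B ^ 2 + (n : ℝ)⁻¹ * pol.weightPotential s₁ V 0
      + N.B ^ 2 * ((n : ℝ)⁻¹ * ∑ t ∈ Finset.range n,
            pol.stateMean (t + 1) (killed s₁ (passageMoment N.P s₁ 1)))
      + (N.B ^ 2 / 2 * ((n : ℝ)⁻¹ * pol.stateMean n (killed s₁ (passageMoment N.P s₁ 2)))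
        + N.deltaMax * V * ((n : ℝ)⁻¹ * pol.stateMean n (killed s₁ (passageMoment N.P s₁ 1)))))
      + V * N.deltaMax
        * max (T * ((n : ℝ)⁻¹ * ∑ t ∈ Finset.range n, pol.visitProb s₁ t)) 1) := by
    rw [le_inv_mul_iff₀ hη0]
    linarith
  linarith

end

end Policy

end StochasticNetwork

/-! ### The stated constants -/

/-- The derived bound has only half of C B²/η. As η ≤ δ, the term r δ D/(2T₁) is at most the other
half, so D B²/2 is left over as slack. -/
theorem backlog_bound_arith {r δ η V T₁ T₂ : ℝ} (hr : 0 ≤ r) (hη : 0 < η) (hηδ : η ≤ δ)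
    (hV : 0 ≤ V) (hT : 1 ≤ T₁) (hT₂ : T₁ ≤ T₂) :
    η⁻¹ * (r * δ ^ 2 * (T₂ + T₁) / (2 * T₁) + V * δ) + r * δ * ((T₂ - T₁) / (2 * T₁))
      ≤ ((T₂ + T₁) * (r * δ ^ 2) + T₁ * V * δ) / η + (T₂ - T₁) * (r * δ ^ 2) / 2 := by
  have hδ : 0 < δ := hη.trans_le hηδ
  have h1 : r * δ ^ 2 * (T₂ + T₁) / (2 * T₁) ≤ r * δ ^ 2 * (T₂ + T₁) / 2 :=
    div_le_div_of_nonneg_left (mul_nonneg (by positivity) (by linarith)) (by norm_num)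
      (by linarith)
  have h2 : (T₂ - T₁) / (2 * T₁) ≤ (T₂ - T₁) / 2 :=
    div_le_div_of_nonneg_left (by linarith) (by norm_num) (by linarith)
  have h3 : r * δ ≤ η⁻¹ * (r * δ ^ 2) := by
    rw [le_inv_mul_iff₀ hη]
    nlinarith [mul_le_mul_of_nonneg_right hηδ (mul_nonneg hr hδ.le)]
  have h4 : r * δ * ((T₂ - T₁) / (2 * T₁)) ≤ η⁻¹ * (r * δ ^ 2) * ((T₂ + T₁) / 2) :=
    mul_le_mul h3 (by linarith) (div_nonneg (by linarith) (by linarith)) (by positivity)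
  have h5 : V * δ ≤ T₁ * V * δ := by nlinarith [mul_nonneg hV hδ.le]
  have h6 : 0 ≤ (T₂ - T₁) * (r * δ ^ 2) / 2 :=
    div_nonneg (mul_nonneg (by linarith) (by positivity)) (by norm_num)
  have h7 := mul_le_mul_of_nonneg_left (add_le_add h1 h5) (inv_nonneg.2 hη.le)
  have h8 : ((T₂ + T₁) * (r * δ ^ 2) + T₁ * V * δ) / η
      = η⁻¹ * (r * δ ^ 2 * (T₂ + T₁) / 2 + T₁ * V * δ)
        + η⁻¹ * (r * δ ^ 2) * ((T₂ + T₁) / 2) := by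
    field_simp; ring
  rw [h8]
  linarith

theorem theorem2 {S : Type v} [Countable S] {X : Type w} [TopologicalSpace X] [MeasurableSpace X]
    [BorelSpace X] {r : ℕ} (hr : 1 ≤ r) (N : StochasticNetwork S X r) (η : ℝ)
    (hη : N.Slackness η) (s₁ : S)
    (hs₁ : ∀ j, MarkovChain.hittingMoment N.P 2 j s₁ < ⊤) :
    (∀ V : ℝ, 1 ≤ V → ∀ (s₀ : S) (pol : StochasticNetwork.Policy.{u} N s₀), pol.IsQLA V →
      pol.avgCost ≤ StochasticNetwork.optCost.{u} N s₀
          + ((N.constC s₁ * N.B ^ 2 / (V * MarkovChain.meanReturn N.P s₁) : ℝ) : EReal) ∧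
      pol.avgBacklog ≤
        (((N.constC s₁ * N.B ^ 2 + MarkovChain.meanReturn N.P s₁ * V * N.deltaMax) / η
          + N.constD s₁ * N.B ^ 2 / 2 : ℝ) : EReal)) ∧
    ∃ K : ℝ, 0 < K ∧
      ∀ V : ℝ, 1 ≤ V → ∀ (s₀ : S) (pol : StochasticNetwork.Policy.{u} N s₀), pol.IsQLA V →
        pol.avgCost ≤ StochasticNetwork.optCost.{u} N s₀ + ((K / V : ℝ) : EReal) ∧
        pol.avgBacklog ≤ ((K * V : ℝ) : EReal) := by
  have hT : 1 ≤ MarkovChain.meanReturn N.P s₁ := by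
    rw [MarkovChain.meanReturn_eq_passageMoment hs₁]
    exact MarkovChain.one_le_passageMoment_one hs₁ s₁
  have hT₂ : MarkovChain.meanReturn N.P s₁ ≤ MarkovChain.secondReturn N.P s₁ := by
    rw [MarkovChain.meanReturn_eq_passageMoment hs₁,
      MarkovChain.secondReturn_eq_passageMoment hs₁]
    exact MarkovChain.passageMoment_one_le_two hs₁ s₁
  have hC : 0 ≤ N.constC s₁ := by rw [StochasticNetwork.constC]; linarith
  have hD : 0 ≤ N.constD s₁ := by rw [StochasticNetwork.constD]; linarith
  have hη0 := hη.1
  have hδ := N.deltaMax_pos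
  have hCB : 0 ≤ N.constC s₁ * N.B ^ 2 := by positivity
  have hDB : 0 ≤ N.constD s₁ * N.B ^ 2 / 2 := by positivity
  have main : ∀ V : ℝ, 1 ≤ V → ∀ (s₀ : S) (pol : StochasticNetwork.Policy.{u} N s₀),
      pol.IsQLA V →
      pol.avgCost ≤ StochasticNetwork.optCost.{u} N s₀
          + ((N.constC s₁ * N.B ^ 2 / (V * MarkovChain.meanReturn N.P s₁) : ℝ) : EReal) ∧
      pol.avgBacklog ≤
        (((N.constC s₁ * N.B ^ 2 + MarkovChain.meanReturn N.P s₁ * V * N.deltaMax) / η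
          + N.constD s₁ * N.B ^ 2 / 2 : ℝ) : EReal) := by
    intro V hV s₀ pol hqla
    have hV0 : 0 < V := by linarith
    constructor
    · refine (StochasticNetwork.Policy.IsQLA.avgCost_le_optCost pol hs₁ hη.feasible_nonempty hV0
        hqla).trans (add_le_add le_rfl (EReal.coe_le_coe_iff.2 ?_))
      have : 0 < V * MarkovChain.meanReturn N.P s₁ := by positivity
      exact div_le_div_of_nonneg_left hCB this (by linarith)
    · refine (StochasticNetwork.Policy.IsQLA.avgBacklog_le pol hs₁ hη hV0.le hqla).trans
        (EReal.coe_le_coe_iff.2 ?_)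
      rw [StochasticNetwork.B_sq, StochasticNetwork.constC, StochasticNetwork.constD]
      exact backlog_bound_arith (Nat.cast_nonneg r) hη0 (hη.le_deltaMax hr) hV0.le hT hT₂
  -- The sum of the constants at V = 1: the first term handles the cost, since the mean return time
  -- is at least 1, and the others handle the backlog, since V ≥ 1.
  refine ⟨main, N.constC s₁ * N.B ^ 2
    + (N.constC s₁ * N.B ^ 2 + MarkovChain.meanReturn N.P s₁ * N.deltaMax) / η
    + N.constD s₁ * N.B ^ 2 / 2, by positivity, fun V hV s₀ pol hqla => ?_⟩
  have hV0 : 0 < V := by linarith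
  obtain ⟨h1, h2⟩ := main V hV s₀ pol hqla
  have hq : 0 ≤ (N.constC s₁ * N.B ^ 2 + MarkovChain.meanReturn N.P s₁ * N.deltaMax) / η := by
    positivity
  refine ⟨h1.trans (add_le_add le_rfl (EReal.coe_le_coe_iff.2 ?_)),
    h2.trans (EReal.coe_le_coe_iff.2 ?_)⟩
  · refine div_le_div₀ (by positivity) (by linarith) hV0 ?_
    exact le_mul_of_one_le_right hV0.le hT
  · have h3 : (N.constC s₁ * N.B ^ 2 + MarkovChain.meanReturn N.P s₁ * V * N.deltaMax) / η
        ≤ (N.constC s₁ * N.B ^ 2 + MarkovChain.meanReturn N.P s₁ * N.deltaMax) / η * V := by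
      rw [div_mul_eq_mul_div]
      refine div_le_div_of_nonneg_right ?_ hη0.le
      nlinarith [mul_le_mul_of_nonneg_left hV hCB]
    have h4 := mul_le_mul_of_nonneg_left hV hDB
    have h5 := mul_nonneg hCB hV0.le
    nlinarith
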